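/- Let $d,n\ge 1$. Let $\mathbb B_d$ be the open unit ball of $\mathbb C^d$, $\langle z,w\rangle=\sum_j z_j\overline{w_j}$, and for $\lambda\in\mathbb B_d$ let $$\varphi_\lambda(z)=\frac{\lambda-P_\lambda z-\sqrt{1-\|\lambda\|^2}\,(I-P_\lambda)z}{1-\langle z,\lambda\rangle},$$ where $P_\lambda$ is the orthogonal projection onto $\mathbb C\lambda$ (so $\varphi_0(z)=-z$). Let $d_{ph}(z,w)=\|\varphi_z(w)\|$. Let $\mathbb X_{d,n}=\mathbb B_d^n/S_n$ be the space of unordered $n$-tuples of points of $\mathbb B_d$, with the topology of the metric $d_s([X],[Y])=\min_{\sigma\in S_n}\max_j d_{ph}(x_j,y_{\sigma(j)})$, and let $\mathbb X^0_{d,n}\subset\mathbb X_{d,n}$ be the subspace of the $n$-tuples of distinct points. Let $H^2_d$ be the Drury–Arveson space, the completion of $\mathbb C[z_1,\dots,z_d]$ for the inner product $\langle z^\alpha,z^\beta\rangle=\delta_{\alpha\beta}\,\alpha!/|\alpha|!$, viewed as a Hilbert space of functions on $\mathbb B_d$ with kernel functions $k_\lambda(z)=(1-\langle z,\lambda\rangle)^{-1}$;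 let $\mathcal M_d$ be its multiplier algebra, $M_f$ the operator of multiplication by $f\in\mathcal M_d$, and $M_z=(M_{z_1},\dots,M_{z_d})$. Let $$\mathbb P_{d,n}=\{P\in B(H^2_d): P=P^2=P^*,\ PM_f^*P=M_f^*P\ \text{for all } f\in\mathcal M_d,\ \dim PH^2_d=n\}$$ with the norm topology. For $P\in\mathbb P_{d,n}$ let $A=PM_z|_{PH^2_d}$ and $$\Psi_{d,n}(P)=\sum_{\lambda\in\sigma(A)}\dim R_\lambda(A)\,[\lambda],$$ where $\sigma(A)=\{\lambda\in\mathbb C^d:\bigcap_j\ker(A_j-\lambda_j I)\ne 0\}$ and $R_\lambda(A)=\bigcap_{|\alpha|=n}\ker(A-\lambda I)^\alpha$. This is a well-defined map $\Psi_{d,n}:\mathbb P_{d,n}\to\mathbb X_{d,n}$; put $\mathbb P^0_{d,n}=\Psi_{d,n}^{-1}(\mathbb X^0_{d,n})$. For distinct points $\lambda_1,\dots,\lambda_n\in\mathbb B_d$, in some order, let $b_1=\varphi_{\lambda_1}$, viewed as a row, and for $2\le m\le n$ let $$b_m(z)=b_{m-1}(z)\,U_m\begin{pmatrix}\varphi_{\lambda_m}(z)&0\\0&I_{(m-1)(d-1)}\end{pmatrix},$$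 where $U_m$ is any unitary matrix of size $(m-1)(d-1)+1$ with first column $b_{m-1}(\lambda_m)^*/\|b_{m-1}(\lambda_m)\|$. Write $b_X=b_n$, a row of size $(n-1)(d-1)+d$. Then for every $[X]=\sum_j[\lambda_j]\in\mathbb X^0_{d,n}$ and every ordering of its points such a $b_X$ exists; for every choice of the ordering and of the unitaries, multiplication by $b_X$ defines a bounded partial isometry $M_{b_X}:H^2_d\otimes\mathbb C^{(n-1)(d-1)+d}\to H^2_d$ with range $H^2_d\ominus\mathrm{Span}\{k_{\lambda_1},\dots,k_{\lambda_n}\}$, and $I-M_{b_X}M_{b_X}^*$ belongs to $\mathbb P^0_{d,n}$ and does not depend on the choices. The map $\Phi_{d,n}:\mathbb X^0_{d,n}\to\mathbb P^0_{d,n}$, $[X]\mapsto I-M_{b_X}M_{b_X}^*$, is continuous, $\Psi_{d,n}\circ\Phi_{d,n}=\mathrm{Id}_{\mathbb X^0_{d,n}}$ and $\Phi_{d,n}\circ\Psi_{d,n}|_{\mathbb P^0_{d,n}}=\mathrm{Id}_{\mathbb P^0_{d,n}}$. Hence $\Psi_{d,n}$ restricts to a homeomorphism from $\mathbb P^0_{d,n}$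 onto $\mathbb X^0_{d,n}$ with inverse $\Phi_{d,n}$. -/

import Mathlib

open scoped InnerProductSpace

noncomputable section

/-! ### The unit ball, its involutions and the symmetrized polyball -/

/-- The open Euclidean unit ball of `ℂ^d`. -/
abbrev UnitBall (d : ℕ) : Type :=
  Metric.ball (0 : EuclideanSpace ℂ (Fin d)) 1

/-- The orthogonal projection `P_λ z = ‖λ‖⁻² ⟨z, λ⟩ λ` onto the line spanned by `lam` (zero if
`lam = 0`). Mathlib's inner product is conjugate-linear in its first slot, so `⟨z, λ⟩` is
`⟪lam, z⟫_ℂ`. -/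
def lineProj {d : ℕ} (lam z : EuclideanSpace ℂ (Fin d)) : EuclideanSpace ℂ (Fin d) :=
  (⟪lam, z⟫_ℂ / (‖lam‖ : ℂ) ^ 2) • lam

/-- The involution `φ_λ` of the ball that exchanges `0` and `lam`; `φ_0 z = -z`. -/
def ballInvolution {d : ℕ} (lam z : EuclideanSpace ℂ (Fin d)) : EuclideanSpace ℂ (Fin d) :=
  (1 - ⟪lam, z⟫_ℂ)⁻¹ •
    (lam - lineProj lam z - (Real.sqrt (1 - ‖lam‖ ^ 2) : ℂ) • (z - lineProj lam z))

/-- The pseudohyperbolic distance on the ball. -/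
def pseudohyperbolicDist {d : ℕ} (z w : UnitBall d) : ℝ :=
  ‖ballInvolution (z : EuclideanSpace ℂ (Fin d)) w‖

/-- The symmetrized polyball: unordered `n`-tuples of points of the ball, with multiplicity. -/
def SymPolyball (d n : ℕ) : Type :=
  Sym (UnitBall d) n

/-- The symmetrization map from ordered to unordered `n`-tuples. -/
def symmetrize {d n : ℕ} (x : Fin n → UnitBall d) : SymPolyball d n :=
  Sym.mk (Finset.univ.val.map x) (by simp)

/-- The symmetric distance: the least value of `max_j d_ph(x_j, y_j)` over all orderings `x`, `y`
of the two unordered tuples. -/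
def symDist {d n : ℕ} (X Y : SymPolyball d n) : ℝ :=
  sInf {r : ℝ | ∃ x y : Fin n → UnitBall d, symmetrize x = X ∧ symmetrize y = Y ∧
    r = ⨆ j, pseudohyperbolicDist (x j) (y j)}

/-- The topology of the distance `symDist`. -/
instance (d n : ℕ) : TopologicalSpace (SymPolyball d n) where
  IsOpen U := ∀ X ∈ U, ∃ ε > 0, ∀ Y, symDist X Y < ε → Y ∈ U
  isOpen_univ := fun _ _ => ⟨1, one_pos, fun _ _ => trivial⟩
  isOpen_inter := by
    intro U V hU hV X hX
    obtain ⟨ε, hε, h⟩ := hU X hX.1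
    obtain ⟨δ, hδ, h'⟩ := hV X hX.2
    exact ⟨min ε δ, lt_min hε hδ, fun Y hY =>
      ⟨h Y (hY.trans_le (min_le_left _ _)), h' Y (hY.trans_le (min_le_right _ _))⟩⟩
  isOpen_sUnion := by
    intro S hS X hX
    obtain ⟨U, hU, hXU⟩ := hX
    obtain ⟨ε, hε, h⟩ := hS U hU X hXU
    exact ⟨ε, hε, fun Y hY => ⟨U, hU, h Y hY⟩⟩

/-- The configuration space of `n` distinct unordered points of the ball. -/
def configSpace (d n : ℕ) : Set (SymPolyball d n) :=
  symmetrize '' {x : Fin n → UnitBall d | Function.Injective x}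

/-! ### The Drury-Arveson space -/

/-- The Drury-Arveson space in `d` variables, the completion of the polynomials for the inner
product with `⟨z^α, z^β⟩ = δ_{αβ} α! / |α|!`. The sequence `c` represents the function
`∑_α c_α (|α|! / α!)^{1/2} z^α`, so that the unit vectors of `ℓ²` represent the normalized
monomials. -/
def DruryArveson (d : ℕ) : Type :=
  lp (fun _ : Fin d → ℕ => ℂ) 2

namespace DruryArveson

instance (d : ℕ) : NormedAddCommGroup (DruryArveson d) :=
  inferInstanceAs (NormedAddCommGroup (lp (fun _ : Fin d → ℕ => ℂ) 2))

instance (d : ℕ) : InnerProductSpace ℂ (DruryArveson d) :=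
  inferInstanceAs (InnerProductSpace ℂ (lp (fun _ : Fin d → ℕ => ℂ) 2))

instance (d : ℕ) : CompleteSpace (DruryArveson d) :=
  inferInstanceAs (CompleteSpace (lp (fun _ : Fin d → ℕ => ℂ) 2))

/-- The coefficients of an element with respect to the normalized monomials. -/
def coeff {d : ℕ} (f : DruryArveson d) (α : Fin d → ℕ) : ℂ :=
  (show lp (fun _ : Fin d → ℕ => ℂ) 2 from f) α

/-- The value at `z` of the normalized monomial `(|α|! / α!)^{1/2} z^α`. -/
def normMonomial {d : ℕ} (α : Fin d → ℕ) (z : EuclideanSpace ℂ (Fin d)) : ℂ :=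
  (Real.sqrt (((∑ j, α j).factorial : ℝ) / ∏ j, ((α j).factorial : ℝ)) : ℂ) * ∏ j, z j ^ α j

/-- The value `∑_α c_α (|α|! / α!)^{1/2} z^α` of an element at a point of the ball. -/
def evalAt {d : ℕ} (f : DruryArveson d) (z : UnitBall d) : ℂ :=
  ∑' α, coeff f α * normMonomial α z

theorem norm_normMonomial_sq {d : ℕ} (α : Fin d → ℕ) (z : EuclideanSpace ℂ (Fin d)) :
    ‖normMonomial α z‖ ^ 2 = Nat.multinomial Finset.univ α * ∏ j, (‖z j‖ ^ 2) ^ α j := by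
  have hm : ((∑ j, α j).factorial : ℝ) / ∏ j, ((α j).factorial : ℝ)
      = Nat.multinomial Finset.univ α := by
    rw [div_eq_iff (by positivity), mul_comm]
    exact_mod_cast (Nat.multinomial_spec Finset.univ α).symm
  rw [normMonomial, hm, norm_mul, mul_pow, norm_prod, Complex.norm_real, Real.norm_eq_abs, sq_abs,
    Real.sq_sqrt (Nat.cast_nonneg _), ← Finset.prod_pow]
  congr 1
  refine Finset.prod_congr rfl fun j _ => ?_
  rw [norm_pow, ← pow_mul, ← pow_mul, mul_comm]

/-- The kernel sequence `α ↦ conj (e_α(z))`, where `e_α` are the normalized monomials. -/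
theorem memℓp_conj_normMonomial {d : ℕ} (z : UnitBall d) :
    Memℓp (fun α : Fin d → ℕ => (starRingEnd ℂ) (normMonomial α z)) 2 := by
  set s : ℝ := ∑ j, ‖(z : EuclideanSpace ℂ (Fin d)) j‖ ^ 2 with hs
  have hs0 : 0 ≤ s := Finset.sum_nonneg fun j _ => by positivity
  have hs1 : s < 1 := by
    have h1 : ‖(z : EuclideanSpace ℂ (Fin d))‖ < 1 := mem_ball_zero_iff.1 z.2
    rw [hs, ← EuclideanSpace.norm_sq_eq]
    nlinarith [norm_nonneg (z : EuclideanSpace ℂ (Fin d))]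
  refine memℓp_gen' (C := (1 - s)⁻¹) fun S => ?_
  have hterm : ∀ α : Fin d → ℕ, ‖(starRingEnd ℂ) (normMonomial α z)‖ ^ (2 : ENNReal).toReal
      = Nat.multinomial Finset.univ α *
        ∏ j, (‖(z : EuclideanSpace ℂ (Fin d)) j‖ ^ 2) ^ α j := by
    intro α
    rw [RCLike.norm_conj, ← norm_normMonomial_sq]
    norm_num
  simp_rw [hterm]
  set N := S.sup (fun α => ∑ j, α j) + 1 with hN
  calc _ ≤ ∑ α ∈ (Finset.range N).biUnion (fun m => Finset.piAntidiag Finset.univ m),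
        (Nat.multinomial Finset.univ α : ℝ) *
          ∏ j, (‖(z : EuclideanSpace ℂ (Fin d)) j‖ ^ 2) ^ α j := by
        refine Finset.sum_le_sum_of_subset_of_nonneg ?_ fun _ _ _ => by positivity
        intro α hα
        simp only [Finset.mem_biUnion, Finset.mem_range, Finset.mem_piAntidiag]
        refine ⟨∑ j, α j, ?_, rfl, by simp⟩
        have := Finset.le_sup (f := fun α : Fin d → ℕ => ∑ j, α j) hα
        omega
    _ = ∑ m ∈ Finset.range N, s ^ m := by
        rw [Finset.sum_biUnion]
        · refine Finset.sum_congr rfl fun m _ => ?_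
          rw [hs, Finset.sum_pow_eq_sum_piAntidiag]
        · intro a _ b _ hab
          refine Finset.disjoint_left.2 fun α h1 h2 => hab ?_
          rw [← (Finset.mem_piAntidiag.1 h1).1, ← (Finset.mem_piAntidiag.1 h2).1]
    _ ≤ ∑' m, s ^ m :=
        (summable_geometric_of_lt_one hs0 hs1).sum_le_tsum _ fun _ _ => by positivity
    _ = (1 - s)⁻¹ := tsum_geometric_of_lt_one hs0 hs1

/-- The kernel function `k_z`, as a sequence of coefficients. -/
def kernelVec {d : ℕ} (z : UnitBall d) : DruryArveson d :=
  (⟨_, memℓp_conj_normMonomial z⟩ : lp (fun _ : Fin d → ℕ => ℂ) 2)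

theorem hasSum_evalAt {d : ℕ} (f : DruryArveson d) (z : UnitBall d) :
    HasSum (fun α => coeff f α * normMonomial α z) ⟪kernelVec z, f⟫_ℂ := by
  have h := lp.hasSum_inner (𝕜 := ℂ) (G := fun _ : Fin d → ℕ => ℂ) (kernelVec z) f
  have e : (fun α => coeff f α * normMonomial α z) = fun α : Fin d → ℕ =>
      ⟪(show lp (fun _ : Fin d → ℕ => ℂ) 2 from kernelVec z) α,
        (show lp (fun _ : Fin d → ℕ => ℂ) 2 from f) α⟫_ℂ := by
    funext α
    simp [kernelVec, coeff, RCLike.inner_apply]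
  rw [e]
  exact h

theorem evalAt_eq_inner {d : ℕ} (f : DruryArveson d) (z : UnitBall d) :
    evalAt f z = ⟪kernelVec z, f⟫_ℂ :=
  (hasSum_evalAt f z).tsum_eq

/-- An element whose values all vanish is zero. -/
theorem eq_zero_of_evalAt {d : ℕ} (f : DruryArveson d) (hf : ∀ z, evalAt f z = 0) : f = 0 := by
  classical
  have hhom : ∀ (m : ℕ) (z : UnitBall d),
      ∑ α ∈ Finset.piAntidiag Finset.univ m, coeff f α * normMonomial α z = 0 := by
    intro m z
    set a : ℕ → ℂ := fun m =>
      ∑ α ∈ Finset.piAntidiag Finset.univ m, coeff f α * normMonomial α z with ha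
    have key : ∀ t : ℂ, ‖t‖ < 1 → HasSum (fun m => t ^ m • a m) 0 := by
      intro t ht
      have hz : ‖(z : EuclideanSpace ℂ (Fin d))‖ < 1 := mem_ball_zero_iff.1 z.2
      have htz : t • (z : EuclideanSpace ℂ (Fin d)) ∈
          Metric.ball (0 : EuclideanSpace ℂ (Fin d)) 1 := by
        rw [mem_ball_zero_iff, norm_smul]
        nlinarith [norm_nonneg t, norm_nonneg (z : EuclideanSpace ℂ (Fin d))]
      have h := hasSum_evalAt f ⟨_, htz⟩
      rw [← evalAt_eq_inner, hf] at h
      rw [← (Equiv.sigmaFiberEquiv (fun α : Fin d → ℕ => ∑ j, α j)).hasSum_iff] at h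
      refine h.sigma fun m => ?_
      have e2 : ∀ α : {α : Fin d → ℕ // ∑ j, α j = m},
          coeff f α * normMonomial (α : Fin d → ℕ) (t • (z : EuclideanSpace ℂ (Fin d)))
            = t ^ m * (coeff f α * normMonomial (α : Fin d → ℕ) z) := by
        rintro ⟨α, rfl⟩
        simp only [normMonomial, PiLp.smul_apply, smul_eq_mul, mul_pow, Finset.prod_mul_distrib,
          Finset.prod_pow_eq_pow_sum]
        ring
      have e3 : t ^ m • a m = ∑ α ∈ Finset.piAntidiag Finset.univ m,
          t ^ m * (coeff f α * normMonomial (α : Fin d → ℕ) z) := by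
        rw [ha, smul_eq_mul, Finset.mul_sum]
      rw [e3]
      have hF : HasSum (fun α : {α : Fin d → ℕ // α ∈ Finset.piAntidiag Finset.univ m} =>
          t ^ m * (coeff f α * normMonomial (α : Fin d → ℕ) z))
          (∑ α ∈ Finset.piAntidiag Finset.univ m,
            t ^ m * (coeff f α * normMonomial (α : Fin d → ℕ) z)) :=
        Finset.hasSum _ (fun α : Fin d → ℕ =>
          t ^ m * (coeff f α * normMonomial (α : Fin d → ℕ) z))
      let E : {α : Fin d → ℕ // ∑ j, α j = m} ≃
          {α : Fin d → ℕ // α ∈ Finset.piAntidiag Finset.univ m} :=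
        Equiv.subtypeEquivRight fun α => by simp [Finset.mem_piAntidiag]
      rw [← E.hasSum_iff] at hF
      convert! hF using 1
      funext α
      exact e2 α
    have hp : HasFPowerSeriesAt (fun _ : ℂ => (0 : ℂ))
        (FormalMultilinearSeries.ofScalars ℂ a) 0 := by
      rw [hasFPowerSeriesAt_iff]
      filter_upwards [Metric.ball_mem_nhds (0 : ℂ) one_pos] with t ht
      simpa [FormalMultilinearSeries.coeff_ofScalars] using key t (by simpa using ht)
    have h0 := hp.eq_zero
    have h1 : (FormalMultilinearSeries.ofScalars ℂ a).coeff m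
        = (0 : FormalMultilinearSeries ℂ ℂ ℂ).coeff m := by rw [h0]
    rw [FormalMultilinearSeries.coeff_ofScalars] at h1
    simpa [FormalMultilinearSeries.coeff] using h1
  have hw : ∀ α : Fin d → ℕ,
      (Real.sqrt (((∑ j, α j).factorial : ℝ) / ∏ j, ((α j).factorial : ℝ)) : ℂ) ≠ 0 := by
    intro α
    exact_mod_cast (Real.sqrt_pos.2 (by positivity)).ne'
  have hcoeff : ∀ α, coeff f α = 0 := by
    intro β
    set m := ∑ j, β j with hm
    set q : MvPolynomial (Fin d) ℂ := ∑ α ∈ Finset.piAntidiag Finset.univ m,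
      MvPolynomial.monomial (Finsupp.equivFunOnFinite.symm α) (coeff f α *
        (Real.sqrt (((∑ j, α j).factorial : ℝ) / ∏ j, ((α j).factorial : ℝ)) : ℂ)) with hq
    have hqe : ∀ z : Fin d → ℂ, MvPolynomial.eval z q
        = ∑ α ∈ Finset.piAntidiag Finset.univ m, coeff f α * normMonomial α (WithLp.toLp 2 z) := by
      intro z
      rw [hq, map_sum]
      refine Finset.sum_congr rfl fun α _ => ?_
      rw [MvPolynomial.eval_monomial, normMonomial, Finsupp.prod_fintype _ _ (by simp)]
      simp [mul_assoc]
    have hq0 : q = 0 := by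
      refine MvPolynomial.funext fun z => ?_
      rw [hqe, map_zero]
      set v : EuclideanSpace ℂ (Fin d) := WithLp.toLp 2 z with hv
      set r : ℂ := (((1 + ‖v‖)⁻¹ : ℝ) : ℂ) with hr
      have hr0 : r ≠ 0 := by
        rw [hr]
        exact_mod_cast (inv_pos.2 (by positivity : (0 : ℝ) < 1 + ‖v‖)).ne'
      have hrv : r • v ∈ Metric.ball (0 : EuclideanSpace ℂ (Fin d)) 1 := by
        rw [mem_ball_zero_iff, norm_smul, hr, Complex.norm_real, Real.norm_eq_abs,
          abs_of_nonneg (by positivity), inv_mul_lt_iff₀ (by positivity)]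
        linarith
      have h := hhom m ⟨_, hrv⟩
      have h' : ∑ α ∈ Finset.piAntidiag Finset.univ m, coeff f α * normMonomial α (r • v)
          = r ^ m * ∑ α ∈ Finset.piAntidiag Finset.univ m, coeff f α * normMonomial α v := by
        rw [Finset.mul_sum]
        refine Finset.sum_congr rfl fun α hα => ?_
        rw [← (Finset.mem_piAntidiag.1 hα).1]
        simp only [normMonomial, PiLp.smul_apply, smul_eq_mul, mul_pow, Finset.prod_mul_distrib,
          Finset.prod_pow_eq_pow_sum]
        ring
      rw [h'] at h
      exact (mul_eq_zero.1 h).resolve_left (pow_ne_zero _ hr0)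
    have hc := congrArg (MvPolynomial.coeff (Finsupp.equivFunOnFinite.symm β)) hq0
    rw [hq, MvPolynomial.coeff_sum, Finset.sum_eq_single β] at hc
    · rw [MvPolynomial.coeff_monomial, if_pos rfl, MvPolynomial.coeff_zero] at hc
      exact (mul_eq_zero.1 hc).resolve_right (hw β)
    · intro α _ hα
      rw [MvPolynomial.coeff_monomial, if_neg]
      exact fun h => hα (Finsupp.equivFunOnFinite.symm.injective h)
    · intro h
      exact absurd (Finset.mem_piAntidiag.2 ⟨hm.symm, by simp⟩) h
  exact lp.ext (funext hcoeff)

/-- The Drury-Arveson space as a reproducing kernel Hilbert space of functions on the ball. The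
kernel functions are Mathlib's `RKHS.kerFun`. -/
instance (d : ℕ) : RKHS ℂ (DruryArveson d) (UnitBall d) ℂ where
  coeCLM := ContinuousLinearMap.pi fun z => innerSL ℂ (kernelVec z)
  coeCLM_injective := by
    refine (injective_iff_map_eq_zero _).2 fun f hf => eq_zero_of_evalAt f fun z => ?_
    rw [evalAt_eq_inner]
    exact congrFun hf z

theorem apply_eq_evalAt {d : ℕ} (f : DruryArveson d) (z : UnitBall d) : f z = evalAt f z :=
  (evalAt_eq_inner f z).symm

end DruryArveson

/-! ### Multipliers -/

/-- `T` is the (bounded) operator of multiplication by the function `f`. -/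
def IsMultiplicationOp {d : ℕ} (f : UnitBall d → ℂ)
    (T : DruryArveson d →L[ℂ] DruryArveson d) : Prop :=
  ∀ (g : DruryArveson d) (z : UnitBall d), T g z = f z * g z

/-- The multiplier algebra of the Drury-Arveson space, as a set of functions on the ball. -/
def multiplierAlgebra (d : ℕ) : Set (UnitBall d → ℂ) :=
  {f | ∃ T, IsMultiplicationOp f T}

open Classical in
/-- The multiplication operator `M_f` of a multiplier `f` (zero if `f` is not a multiplier). It is
unique because elements of the space are determined by their values. -/
def mulOp {d : ℕ} (f : UnitBall d → ℂ) : DruryArveson d →L[ℂ] DruryArveson d :=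
  if h : ∃ T, IsMultiplicationOp f T then h.choose else 0

/-- The coordinate multiplication operators `M_{z_j}`. -/
def coordShift {d : ℕ} (j : Fin d) : DruryArveson d →L[ℂ] DruryArveson d :=
  mulOp fun z => (z : EuclideanSpace ℂ (Fin d)) j

/-- `M` is the (bounded) operator `M_b` of multiplication by the row `b = (b_1, …, b_N)`, from the
direct sum of `N` copies of the Drury-Arveson space to the Drury-Arveson space. -/
def IsRowMultiplicationOp {d N : ℕ} (b : UnitBall d → EuclideanSpace ℂ (Fin N))
    (M : PiLp 2 (fun _ : Fin N => DruryArveson d) →L[ℂ] DruryArveson d) : Prop :=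
  ∀ (G : PiLp 2 (fun _ : Fin N => DruryArveson d)) (z : UnitBall d),
    M G z = ∑ i, b z i * G i z

/-! ### Blaschke-type row multipliers -/

/-- The row `b(z) U A(z)`, where `A(z)` is the block diagonal matrix with blocks the row
`φ_λ(z)` of size `d` and the identity of size `k`. -/
def blaschkeStep {d k : ℕ} (b : UnitBall d → EuclideanSpace ℂ (Fin (k + 1)))
    (U : Matrix (Fin (k + 1)) (Fin (k + 1)) ℂ) (lam : UnitBall d) (z : UnitBall d) :
    EuclideanSpace ℂ (Fin (d + k)) :=
  WithLp.toLp 2 (Fin.append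
    (fun j : Fin d => Matrix.vecMul (b z).ofLp U 0 *
      ballInvolution (lam : EuclideanSpace ℂ (Fin d)) z j)
    (fun j : Fin k => Matrix.vecMul (b z).ofLp U j.succ))

/-- `IsBlaschkeRow l N b`: the row `b` of size `N` is obtained by the inductive construction from
the points of the list `l`, in this order, for some choice of the unitary matrices: it starts with
`φ_λ` for the first point, and each further point `lam` replaces the row `b` by
`b U diag(φ_lam, I)`, where `U` is a unitary matrix whose first column is `b(lam)^* / ‖b(lam)‖`. -/
inductive IsBlaschkeRow {d : ℕ} :
    List (UnitBall d) → (N : ℕ) → (UnitBall d → EuclideanSpace ℂ (Fin N)) → Prop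
  | single (lam : UnitBall d) :
      IsBlaschkeRow [lam] d fun z => ballInvolution (lam : EuclideanSpace ℂ (Fin d)) z
  | step {l : List (UnitBall d)} {k : ℕ} {b : UnitBall d → EuclideanSpace ℂ (Fin (k + 1))}
      (lam : UnitBall d) (U : Matrix (Fin (k + 1)) (Fin (k + 1)) ℂ)
      (hb : IsBlaschkeRow l (k + 1) b)
      (hU : U ∈ Matrix.unitaryGroup (Fin (k + 1)) ℂ)
      (hU0 : ∀ i, U i 0 = (starRingEnd ℂ) (b lam i) / (‖b lam‖ : ℂ)) :
      IsBlaschkeRow (l ++ [lam]) (d + k) (blaschkeStep b U lam)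

/-! ### Joint spectra of commuting tuples -/

section JointSpectrum

variable {d : ℕ} {V : Type*} [AddCommGroup V] [Module ℂ V]

/-- The joint spectrum of a commuting tuple on a finite-dimensional space. -/
def jointSpectrum (A : Fin d → Module.End ℂ V) : Set (EuclideanSpace ℂ (Fin d)) :=
  {lam | (⨅ j, LinearMap.ker (A j - lam j • (1 : Module.End ℂ V))) ≠ ⊥}

/-- The root subspace `⋂_{|α| = n} ker (A - λ)^α`, where `n` is the dimension of the space. -/
def rootSubspace (A : Fin d → Module.End ℂ V) (lam : EuclideanSpace ℂ (Fin d)) : Submodule ℂ V :=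
  ⨅ α : {α : Fin d → ℕ // ∑ j, α j = Module.finrank ℂ V},
    LinearMap.ker (List.ofFn fun j => (A j - lam j • (1 : Module.End ℂ V)) ^ (α.1 j)).prod

open Classical in
/-- `X` is the joint spectrum with multiplicities `∑_{λ ∈ σ(A)} dim R_λ(A) [λ]` of the tuple `A`,
and the joint spectrum is contained in the ball. -/
def IsJointSpectrumWithMult {n : ℕ} (A : Fin d → Module.End ℂ V) (X : SymPolyball d n) : Prop :=
  jointSpectrum A ⊆ Metric.ball 0 1 ∧
    ∀ lam : UnitBall d, Multiset.count lam X.1 =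
      if (lam : EuclideanSpace ℂ (Fin d)) ∈ jointSpectrum A then
        Module.finrank ℂ (rootSubspace A lam) else 0

end JointSpectrum

/-! ### The Grassmannian of coinvariant subspaces -/

/-- The orthogonal projections onto `n`-dimensional multiplier coinvariant subspaces of the
Drury-Arveson space, with the topology of the operator norm. -/
def coinvariantProj (d n : ℕ) : Set (DruryArveson d →L[ℂ] DruryArveson d) :=
  {P | P ∘L P = P ∧ ContinuousLinearMap.adjoint P = P ∧
    (∀ f ∈ multiplierAlgebra d, P ∘L ContinuousLinearMap.adjoint (mulOp f) ∘L P =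
      ContinuousLinearMap.adjoint (mulOp f) ∘L P) ∧
    FiniteDimensional ℂ (P : DruryArveson d →ₗ[ℂ] DruryArveson d).range ∧
    Module.finrank ℂ (P : DruryArveson d →ₗ[ℂ] DruryArveson d).range = n}

/-- The compression `P T|_{ran P}` of an operator to the range of `P`. -/
def compression {d : ℕ} (P T : DruryArveson d →L[ℂ] DruryArveson d) :
    Module.End ℂ (P : DruryArveson d →ₗ[ℂ] DruryArveson d).range :=
  (P : DruryArveson d →ₗ[ℂ] DruryArveson d).rangeRestrict ∘ₗ
    (T : DruryArveson d →ₗ[ℂ] DruryArveson d) ∘ₗ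
      (P : DruryArveson d →ₗ[ℂ] DruryArveson d).range.subtype

/-- The compression of the tuple `M_z` of coordinate multiplications to the range of `P`. -/
def compressedShift {d : ℕ} (P : DruryArveson d →L[ℂ] DruryArveson d) (j : Fin d) :
    Module.End ℂ (P : DruryArveson d →ₗ[ℂ] DruryArveson d).range :=
  compression P (coordShift j)

open Classical in
/-- The map `Ψ` sending `P` to the joint spectrum with multiplicities of the compression of `M_z`
to the range of `P`. (The value in the case where there is no such point of the symmetrized
polyball is irrelevant; this case does not occur.) -/
def Psi (d n : ℕ) (P : coinvariantProj d n) : SymPolyball d n :=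
  if h : ∃ X : SymPolyball d n, IsJointSpectrumWithMult (compressedShift P.1) X then h.choose
  else symmetrize fun _ => ⟨0, by simp⟩

/-- The preimage under `Ψ` of the configuration space of `n` distinct points. -/
def coinvariantProjDistinct (d n : ℕ) : Set (coinvariantProj d n) :=
  Psi d n ⁻¹' configSpace d n

end

open scoped InnerProductSpace

noncomputable section

namespace DruryArveson

/-! ### Kernel functions -/

/-! For distinct points everything reduces to one object, the orthogonal projection `kernelProj s`
onto the span of the kernel functions at the points of `s`. The map Φ is taken to be `X ↦ kernelProj
X`; it involves no ordering and no unitaries, so independence of the choices follows once every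
Blaschke row of `X` satisfies `M_b M_b^* = I - kernelProj X`.

Blaschke rows. The identity for `1 - ⟨φ_λ(z), φ_λ(w)⟩` says that `(1 - ⟨φ_λ(z), φ_λ(w)⟩) k(z, w)` is
the kernel of the rank one projection onto `ℂ k_λ`. If `b(z) b(w)^* k(z, w)` is the kernel of `I -
P`, the next factor, thanks to the prescribed first column of the unitary, subtracts exactly the
kernel of the projection onto the line of `(I - P) k_λ`. This is a Gram-Schmidt step
(`IsBlaschkeRow.inner_mul_kernel`). Boundedness of `M_b` comes for free, because the kernel in
question is that of a projection (`exists_isRowMultiplicationOp`).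

Spectrum. The range of `P` is invariant under the adjoints `M_z^*`, whose joint eigenvectors are the
multiples of kernel functions (`eigenvector_eq_smul_kernelVec`). The compression of `M_z` is the
adjoint of that restriction, so the points of Ψ(P) are the `λ` with `k_λ` in the range of `P`
(`mem_Psi_iff`). Multiplicities add up to `n` and kernel functions at distinct points are
independent, so counting shows that Φ and Ψ are mutually inverse.

Continuity. The topology on unordered tuples is the quotient of the Euclidean one
(`isOpen_symPolyball_iff`, `nhds_symmetrize`), so ordered tuples suffice. Φ is continuous because
Gram-Schmidt is, as long as the residual vectors do not vanish. For Ψ, a function vanishing on Ψ(Q),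
of norm bounded independently of `Q`, shows that each point of Ψ(P) has a point of Ψ(Q) nearby when
`‖P - Q‖` is small (`exists_mem_Psi_near`); since the points are distinct, these nearby points
exhaust Ψ(Q). -/

theorem apply_eq_inner {d : ℕ} (f : DruryArveson d) (z : UnitBall d) :
    f z = ⟪kernelVec z, f⟫_ℂ := rfl

theorem kerFun_one {d : ℕ} (z : UnitBall d) :
    RKHS.kerFun (DruryArveson d) z 1 = kernelVec z := by
  refine ext_inner_right ℂ fun f => ?_
  rw [RKHS.kerFun_inner, ← apply_eq_inner]
  simp

/-- A sum over multi-indices may be grouped by degree. -/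
theorem hasSum_sum_piAntidiag {d : ℕ} {E : Type*} [NormedAddCommGroup E]
    {f : (Fin d → ℕ) → E} {s : E} (h : HasSum f s) :
    HasSum (fun m => ∑ α ∈ Finset.piAntidiag Finset.univ m, f α) s := by
  rw [← (Equiv.sigmaFiberEquiv (fun α : Fin d → ℕ => ∑ j, α j)).hasSum_iff] at h
  refine h.sigma fun m => ?_
  have hF : HasSum (fun α : {α : Fin d → ℕ // α ∈ Finset.piAntidiag Finset.univ m} => f α)
      (∑ α ∈ Finset.piAntidiag Finset.univ m, f α) := Finset.hasSum _ _
  let E : {α : Fin d → ℕ // ∑ j, α j = m} ≃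
      {α : Fin d → ℕ // α ∈ Finset.piAntidiag Finset.univ m} :=
    Equiv.subtypeEquivRight fun α => by simp [Finset.mem_piAntidiag]
  rw [← E.hasSum_iff] at hF
  exact hF

/-- The two square-root weights multiply to the multinomial coefficient, which puts the kernel
series into the form of the multinomial theorem. -/
theorem conj_normMonomial_mul {d : ℕ} (α : Fin d → ℕ) (w z : EuclideanSpace ℂ (Fin d)) :
    (starRingEnd ℂ) (normMonomial α w) * normMonomial α z
      = Nat.multinomial Finset.univ α * ∏ j, ((starRingEnd ℂ) (w j) * z j) ^ α j := by
  have hm : ((∑ j, α j).factorial : ℝ) / ∏ j, ((α j).factorial : ℝ)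
      = Nat.multinomial Finset.univ α := by
    rw [div_eq_iff (by positivity), mul_comm]
    exact_mod_cast (Nat.multinomial_spec Finset.univ α).symm
  have hs : ((Real.sqrt (Nat.multinomial Finset.univ α : ℝ) : ℝ) : ℂ)
      * (Real.sqrt (Nat.multinomial Finset.univ α : ℝ) : ℝ) = Nat.multinomial Finset.univ α := by
    rw [← Complex.ofReal_mul, Real.mul_self_sqrt (Nat.cast_nonneg _)]
    simp
  simp only [normMonomial, hm, map_mul, Complex.conj_ofReal, map_prod, map_pow, mul_pow,
    Finset.prod_mul_distrib]
  rw [← hs]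
  ring

theorem norm_coe_lt_one {d : ℕ} (z : UnitBall d) : ‖(z : EuclideanSpace ℂ (Fin d))‖ < 1 :=
  mem_ball_zero_iff.1 z.2

theorem norm_inner_lt_one {d : ℕ} (w z : UnitBall d) :
    ‖⟪(w : EuclideanSpace ℂ (Fin d)), z⟫_ℂ‖ < 1 := by
  refine (norm_inner_le_norm _ _).trans_lt ?_
  have h1 := norm_coe_lt_one w
  have h2 := norm_coe_lt_one z
  nlinarith [norm_nonneg (w : EuclideanSpace ℂ (Fin d)),
    norm_nonneg (z : EuclideanSpace ℂ (Fin d))]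

theorem one_sub_inner_ne_zero {d : ℕ} (w z : UnitBall d) :
    1 - ⟪(w : EuclideanSpace ℂ (Fin d)), z⟫_ℂ ≠ 0 := by
  intro h
  have := norm_inner_lt_one w z
  rw [← sub_eq_zero.1 h] at this
  simp at this

theorem inner_eq_sum_conj_mul {d : ℕ} (w z : EuclideanSpace ℂ (Fin d)) :
    ⟪w, z⟫_ℂ = ∑ j, (starRingEnd ℂ) (w j) * z j := by
  simp [PiLp.inner_apply, RCLike.inner_apply, mul_comm]

/-- Grouped by degree, the series is geometric in `⟨z, w⟩` by the multinomial theorem. -/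
theorem inner_kernelVec {d : ℕ} (z w : UnitBall d) :
    ⟪kernelVec z, kernelVec w⟫_ℂ = (1 - ⟪(w : EuclideanSpace ℂ (Fin d)), z⟫_ℂ)⁻¹ := by
  have h := hasSum_sum_piAntidiag (hasSum_evalAt (kernelVec w) z)
  have e : ∀ m : ℕ, ∑ α ∈ Finset.piAntidiag Finset.univ m,
      coeff (kernelVec w) α * normMonomial α z
        = ⟪(w : EuclideanSpace ℂ (Fin d)), z⟫_ℂ ^ m := by
    intro m
    rw [inner_eq_sum_conj_mul, Finset.sum_pow_eq_sum_piAntidiag]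
    exact Finset.sum_congr rfl fun α _ => conj_normMonomial_mul α w z
  simp_rw [e] at h
  exact h.unique (hasSum_geometric_of_norm_lt_one (norm_inner_lt_one w z))

theorem kernelVec_ne_zero {d : ℕ} (z : UnitBall d) : kernelVec z ≠ 0 := by
  intro h
  have := inner_kernelVec z z
  rw [h, inner_zero_left] at this
  exact inv_ne_zero (one_sub_inner_ne_zero z z) this.symm

/-- The squared distance of two kernel vectors expands into values of the explicit kernel, which are
continuous. The two cross terms are conjugate, so under the real part they merge into twice one of
them. -/
theorem continuous_kernelVec {d : ℕ} : Continuous (kernelVec (d := d)) := by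
  refine continuous_iff_continuousAt.2 fun w => ?_
  rw [ContinuousAt, tendsto_iff_norm_sub_tendsto_zero]
  have hk : ∀ z : UnitBall d, ‖kernelVec z - kernelVec w‖ ^ 2
      = ((1 - ⟪(z : EuclideanSpace ℂ (Fin d)), z⟫_ℂ)⁻¹
        - 2 * (1 - ⟪(w : EuclideanSpace ℂ (Fin d)), z⟫_ℂ)⁻¹
        + (1 - ⟪(w : EuclideanSpace ℂ (Fin d)), w⟫_ℂ)⁻¹).re := by
    intro z
    rw [@norm_sub_sq ℂ, ← inner_kernelVec, ← inner_kernelVec, ← inner_kernelVec,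
      inner_self_eq_norm_sq_to_K, inner_self_eq_norm_sq_to_K]
    simp [← Complex.ofReal_pow]
  have hc : Continuous fun z : UnitBall d => ((1 - ⟪(z : EuclideanSpace ℂ (Fin d)), z⟫_ℂ)⁻¹
        - 2 * (1 - ⟪(w : EuclideanSpace ℂ (Fin d)), z⟫_ℂ)⁻¹
        + (1 - ⟪(w : EuclideanSpace ℂ (Fin d)), w⟫_ℂ)⁻¹).re := by
    refine Complex.continuous_re.comp (((Continuous.inv₀ (by fun_prop)
      fun z => one_sub_inner_ne_zero z z).sub (continuous_const.mul (Continuous.inv₀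
        (by fun_prop) fun z => one_sub_inner_ne_zero w z))).add continuous_const)
  have h2 : Filter.Tendsto (fun z => ‖kernelVec z - kernelVec w‖ ^ 2) (nhds w) (nhds 0) := by
    simp_rw [hk]
    have := hc.tendsto w
    refine this.trans (le_of_eq ?_)
    congr 1
    rw [← hk w, sub_self, norm_zero]
    simp
  simpa using (Real.continuous_sqrt.tendsto _).comp h2 |>.congr fun z => Real.sqrt_sq (norm_nonneg _)

end DruryArveson

/-! ### The involutions of the ball -/

open DruryArveson

theorem inner_lineProj_sub {d : ℕ} (lam z w : EuclideanSpace ℂ (Fin d)) (h : lam ≠ 0) :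
    ⟪lam, z - lineProj lam z⟫_ℂ = 0 ∧ ⟪z - lineProj lam z, lam⟫_ℂ = 0 ∧
    ⟪z - lineProj lam z, w - lineProj lam w⟫_ℂ
      = ⟪z, w⟫_ℂ - ⟪z, lam⟫_ℂ * ⟪lam, w⟫_ℂ / (‖lam‖ : ℂ) ^ 2 := by
  have h0 : (‖lam‖ : ℂ) ≠ 0 := by simpa using h
  have hll : ⟪lam, lam⟫_ℂ = (‖lam‖ : ℂ) ^ 2 := inner_self_eq_norm_sq_to_K lam
  have c1 : (starRingEnd ℂ) ⟪lam, z⟫_ℂ = ⟪z, lam⟫_ℂ := inner_conj_symm _ _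
  refine ⟨?_, ?_, ?_⟩ <;>
  simp only [lineProj, inner_sub_left, inner_sub_right, inner_smul_left, inner_smul_right, hll,
    map_div₀, map_pow, Complex.conj_ofReal, c1] <;> field_simp <;> ring

/-- Split the numerators of the two involutions into their components along `lam` and orthogonal to
it; the square of the factor `s` on the orthogonal component is `1 - ‖lam‖ ^ 2`. The point `lam = 0`
is separate because the projection formula divides by `‖lam‖ ^ 2`. -/
theorem one_sub_inner_ballInvolution {d : ℕ} (lam z w : UnitBall d) :
    1 - ⟪ballInvolution (lam : EuclideanSpace ℂ (Fin d)) w,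
        ballInvolution (lam : EuclideanSpace ℂ (Fin d)) z⟫_ℂ
      = (1 - ⟪(lam : EuclideanSpace ℂ (Fin d)), lam⟫_ℂ) *
        (1 - ⟪(w : EuclideanSpace ℂ (Fin d)), z⟫_ℂ) /
        ((1 - ⟪(lam : EuclideanSpace ℂ (Fin d)), z⟫_ℂ) *
          (1 - ⟪(w : EuclideanSpace ℂ (Fin d)), lam⟫_ℂ)) := by
  have n1 := one_sub_inner_ne_zero lam z
  have n2 := one_sub_inner_ne_zero w lam
  have hlt := norm_coe_lt_one lam
  obtain ⟨lam, hl⟩ := lam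
  obtain ⟨z, hz⟩ := z
  obtain ⟨w, hw⟩ := w
  simp only at *
  have c1 : (starRingEnd ℂ) ⟪lam, w⟫_ℂ = ⟪w, lam⟫_ℂ := inner_conj_symm _ _
  by_cases h : lam = 0
  · subst h
    simp [ballInvolution, lineProj]
  have hs : (Real.sqrt (1 - ‖lam‖ ^ 2) : ℂ) * (Real.sqrt (1 - ‖lam‖ ^ 2) : ℂ)
      = 1 - (‖lam‖ : ℂ) ^ 2 := by
    rw [← Complex.ofReal_mul, Real.mul_self_sqrt (by nlinarith [norm_nonneg lam])]
    simp
  have h0 : (‖lam‖ : ℂ) ≠ 0 := by simpa using h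
  have hll : ⟪lam, lam⟫_ℂ = (‖lam‖ : ℂ) ^ 2 := inner_self_eq_norm_sq_to_K lam
  obtain ⟨-, hw1, hwz⟩ := inner_lineProj_sub lam w z h
  obtain ⟨hz1, -, -⟩ := inner_lineProj_sub lam z w h
  have hd : ∀ x : EuclideanSpace ℂ (Fin d),
      lam - lineProj lam x = (1 - ⟪lam, x⟫_ℂ / (‖lam‖ : ℂ) ^ 2) • lam := by
    intro x
    rw [lineProj, sub_smul, one_smul]
  set s := (Real.sqrt (1 - ‖lam‖ ^ 2) : ℂ)
  have cs : (starRingEnd ℂ) s = s := Complex.conj_ofReal _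
  have key : ⟪lam - lineProj lam w - s • (w - lineProj lam w),
      lam - lineProj lam z - s • (z - lineProj lam z)⟫_ℂ
      = (‖lam‖ : ℂ) ^ 2 * (1 - ⟪w, lam⟫_ℂ / (‖lam‖ : ℂ) ^ 2) * (1 - ⟪lam, z⟫_ℂ / (‖lam‖ : ℂ) ^ 2)
        + (1 - (‖lam‖ : ℂ) ^ 2) * (⟪w, z⟫_ℂ - ⟪w, lam⟫_ℂ * ⟪lam, z⟫_ℂ / (‖lam‖ : ℂ) ^ 2) := by
    rw [hd, hd, inner_sub_left, inner_sub_right, inner_sub_right]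
    simp only [inner_smul_left, inner_smul_right, hw1, hz1, hwz, hll, cs, map_sub, map_div₀,
      map_one, map_pow, Complex.conj_ofReal, c1]
    rw [← hs]
    ring
  simp only [ballInvolution]
  rw [inner_smul_left, inner_smul_right, key, map_inv₀, map_sub, map_one, c1, hll]
  field_simp
  ring

/-! ### Row multipliers from kernel identities -/

/-- A vector orthogonal to all kernel functions is a function with all values zero. -/
theorem dense_span_kernelVec {d : ℕ} :
    DenseRange (Finsupp.linearCombination ℂ (kernelVec (d := d))) := by
  have h : (LinearMap.range (Finsupp.linearCombination ℂ (kernelVec (d := d)))).topologicalClosure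
      = ⊤ := by
    rw [Submodule.topologicalClosure_eq_top_iff, Submodule.eq_bot_iff]
    intro f hf
    refine RKHS.ext (𝕜 := ℂ) (X := UnitBall d) (V := ℂ) fun z => ?_
    rw [apply_eq_inner, apply_eq_inner, inner_zero_right]
    refine hf _ ⟨Finsupp.single z 1, by simp⟩
  exact (Submodule.dense_iff_topologicalClosure_eq_top.2 h)

/-- Pairing with `k_z` turns evaluation at `z` into an inner product, so acting as a multiplier is a
condition on the adjoint at kernel vectors only. -/
theorem isRowMultiplicationOp_iff {d N : ℕ} {b : UnitBall d → EuclideanSpace ℂ (Fin N)}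
    {M : PiLp 2 (fun _ : Fin N => DruryArveson d) →L[ℂ] DruryArveson d} :
    IsRowMultiplicationOp b M ↔ ∀ z, ContinuousLinearMap.adjoint M (kernelVec z)
      = WithLp.toLp 2 fun i => (starRingEnd ℂ) (b z i) • kernelVec z := by
  have e : ∀ z (G : PiLp 2 (fun _ : Fin N => DruryArveson d)),
      ⟪WithLp.toLp 2 fun i => (starRingEnd ℂ) (b z i) • kernelVec z, G⟫_ℂ
        = ∑ i, b z i * G i z := by
    intro z G
    simp [PiLp.inner_apply, inner_smul_left, apply_eq_inner]
  constructor
  · intro h z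
    refine ext_inner_right ℂ fun G => ?_
    rw [ContinuousLinearMap.adjoint_inner_left, ← apply_eq_inner, h G z, e]
  · intro h G z
    rw [apply_eq_inner, ← ContinuousLinearMap.adjoint_inner_left, h, e]

/-- A row whose kernel `⟨b(z), b(w)⟩ k(z, w)` is the kernel of an orthogonal projection `Q` defines
a bounded multiplication operator `M` with `M M^* = Q`. -/
theorem exists_isRowMultiplicationOp {d N : ℕ} (b : UnitBall d → EuclideanSpace ℂ (Fin N))
    (Q : DruryArveson d →L[ℂ] DruryArveson d)
    (hQ : Q ∘L Q = Q) (hQ' : ContinuousLinearMap.adjoint Q = Q)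
    (h : ∀ z w, ⟪kernelVec z, Q (kernelVec w)⟫_ℂ = ⟪b w, b z⟫_ℂ * ⟪kernelVec z, kernelVec w⟫_ℂ) :
    ∃ M : PiLp 2 (fun _ : Fin N => DruryArveson d) →L[ℂ] DruryArveson d,
      IsRowMultiplicationOp b M ∧ M ∘L ContinuousLinearMap.adjoint M = Q := by
  set e := Finsupp.linearCombination ℂ (kernelVec (d := d)) with he
  set v : UnitBall d → PiLp 2 (fun _ : Fin N => DruryArveson d) := fun z =>
    WithLp.toLp 2 fun i => (starRingEnd ℂ) (b z i) • kernelVec z with hv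
  set f := Finsupp.linearCombination ℂ v with hf
  have hvv : ∀ z w, ⟪v z, v w⟫_ℂ = ⟪kernelVec z, Q (kernelVec w)⟫_ℂ := by
    intro z w
    rw [h, inner_eq_sum_conj_mul, Finset.sum_mul, PiLp.inner_apply]
    refine Finset.sum_congr rfl fun i _ => ?_
    simp only [hv, inner_smul_left, inner_smul_right, Complex.conj_conj]
    ring
  have hfe : ∀ c c', ⟪f c, f c'⟫_ℂ = ⟪e c, Q (e c')⟫_ℂ := by
    intro c c'
    simp only [hf, he, Finsupp.linearCombination_apply, Finsupp.sum, map_sum, sum_inner,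
      inner_sum, map_smul, inner_smul_left, inner_smul_right, hvv]
  -- Since `Q = Q^* Q`, the Gram identity `hfe` says `‖f c‖ = ‖Q (e c)‖`. Hence `f` factors through
  -- `e` and is bounded there.
  have hn : ∀ c, ‖f c‖ ≤ ‖Q‖ * ‖e c‖ := by
    intro c
    have h1 : ‖f c‖ ^ 2 = ‖Q (e c)‖ ^ 2 := by
      have : ⟪f c, f c⟫_ℂ = ⟪Q (e c), Q (e c)⟫_ℂ := by
        rw [hfe, ← ContinuousLinearMap.adjoint_inner_right, hQ', ← ContinuousLinearMap.comp_apply,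
          hQ]
      rw [inner_self_eq_norm_sq_to_K, inner_self_eq_norm_sq_to_K] at this
      exact_mod_cast this
    rw [pow_left_inj₀ (norm_nonneg _) (norm_nonneg _) two_ne_zero] at h1
    rw [h1]
    exact Q.le_opNorm _
  -- `T` is the future `M^*`: the extension of `k_z ↦ conj (b z) ⊗ k_z` from the dense span of the
  -- kernel functions.
  set T := f.extendOfNorm e with hT
  have hTe : ∀ c, T (e c) = f c := LinearMap.extendOfNorm_eq dense_span_kernelVec ⟨_, hn⟩
  have hTk : ∀ z, T (kernelVec z) = v z := by
    intro z
    have := hTe (Finsupp.single z 1)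
    simpa [he, hf] using this
  refine ⟨ContinuousLinearMap.adjoint T, isRowMultiplicationOp_iff.2 fun z => ?_, ?_⟩
  · rw [ContinuousLinearMap.adjoint_adjoint, hTk]
  · rw [ContinuousLinearMap.adjoint_adjoint]
    refine ContinuousLinearMap.ext fun x => ?_
    refine dense_span_kernelVec.induction_on (p := fun x =>
      (ContinuousLinearMap.adjoint T ∘L T) x = Q x) x ?_ ?_
    · exact isClosed_eq (by fun_prop) (by fun_prop)
    · intro c
      refine RKHS.ext (𝕜 := ℂ) (X := UnitBall d) (V := ℂ) fun z => ?_
      rw [apply_eq_inner, apply_eq_inner, ContinuousLinearMap.comp_apply,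
        ContinuousLinearMap.adjoint_inner_right, hTk]
      have h2 := hfe (Finsupp.single z 1) c
      have h3 := hTe c
      rw [he, hf] at h3 h2
      rw [h3]
      simpa using h2

/-- The kernel of a rank one projection. -/
theorem rankOne_involution_kernel {d : ℕ} (lam z w : UnitBall d) :
    (1 - ⟪ballInvolution (lam : EuclideanSpace ℂ (Fin d)) w,
        ballInvolution (lam : EuclideanSpace ℂ (Fin d)) z⟫_ℂ) * ⟪kernelVec z, kernelVec w⟫_ℂ
      = ⟪kernelVec z, kernelVec lam⟫_ℂ * ⟪kernelVec lam, kernelVec w⟫_ℂ /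
        ⟪kernelVec lam, kernelVec lam⟫_ℂ := by
  rw [one_sub_inner_ballInvolution]
  simp only [inner_kernelVec]
  have h1 := one_sub_inner_ne_zero lam z
  have h2 := one_sub_inner_ne_zero w lam
  have h3 := one_sub_inner_ne_zero w z
  have h4 := one_sub_inner_ne_zero lam lam
  field_simp

/-! ### Projections onto finite-dimensional spans -/

section Projection

variable {H : Type*} [NormedAddCommGroup H] [InnerProductSpace ℂ H]

/-- One Gram-Schmidt step. If `v` already lies in the span, the residual is zero and the added term
vanishes, so no independence is assumed. -/
theorem starProjection_span_insert (v : H) (S : Set H)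
    [(Submodule.span ℂ S).HasOrthogonalProjection]
    [(Submodule.span ℂ (insert v S)).HasOrthogonalProjection] (x : H) :
    (Submodule.span ℂ (insert v S)).starProjection x = (Submodule.span ℂ S).starProjection x
      + (⟪v - (Submodule.span ℂ S).starProjection v, x⟫_ℂ /
          (‖v - (Submodule.span ℂ S).starProjection v‖ : ℂ) ^ 2) •
            (v - (Submodule.span ℂ S).starProjection v) := by
  set K := Submodule.span ℂ S with hK
  set u := v - K.starProjection v with hu
  have hKle : K ≤ Submodule.span ℂ (insert v S) := Submodule.span_mono (Set.subset_insert _ _)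
  have huO : u ∈ Kᗮ := Submodule.sub_starProjection_mem_orthogonal v
  have hv : v ∈ Submodule.span ℂ (insert v S) := Submodule.subset_span (Set.mem_insert _ _)
  refine Submodule.eq_starProjection_of_mem_of_inner_eq_zero
    (K := Submodule.span ℂ (insert v S)) ?_ ?_
  · refine add_mem (hKle (Submodule.starProjection_apply_mem _ _)) (Submodule.smul_mem _ _ ?_)
    exact sub_mem hv (hKle (Submodule.starProjection_apply_mem _ _))
  · set r := x - (K.starProjection x + (⟪u, x⟫_ℂ / (‖u‖ : ℂ) ^ 2) • u) with hr
    have hrK : ∀ y ∈ K, ⟪y, r⟫_ℂ = 0 := by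
      intro y hy
      rw [hr, ← sub_sub, inner_sub_right, inner_smul_right, huO y hy,
        Submodule.sub_starProjection_mem_orthogonal x y hy]
      simp
    have hru : ⟪u, r⟫_ℂ = 0 := by
      have h0 : ⟪u, K.starProjection x⟫_ℂ = 0 :=
        (Submodule.mem_orthogonal' _ _).1 huO _ (Submodule.starProjection_apply_mem _ _)
      rw [hr, inner_sub_right, inner_add_right, inner_smul_right, h0, inner_self_eq_norm_sq_to_K]
      by_cases hu0 : u = 0
      · simp [hu0]
      · have : (‖u‖ : ℂ) ≠ 0 := by simpa using hu0
        simp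
        field_simp
        ring
    intro y hy
    rw [← inner_conj_symm]
    have : ⟪y, r⟫_ℂ = 0 := by
      refine Submodule.span_induction (p := fun y _ => ⟪y, r⟫_ℂ = 0) ?_ (by simp) ?_ ?_ hy
      · rintro y (rfl | hy)
        · have : y = u + K.starProjection y := by rw [hu]; abel
          rw [this, inner_add_left, hru, hrK _ (Submodule.starProjection_apply_mem _ _), add_zero]
        · exact hrK _ (Submodule.subset_span hy)
      · intro a b _ _ ha hb
        rw [inner_add_left, ha, hb, add_zero]
      · intro c a _ ha
        rw [inner_smul_left, ha, mul_zero]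
    rw [this, map_zero]

end Projection

/-! ### Spans of kernel functions -/

/-- The span of the kernel functions of the points of `s`. -/
def kernelSpan {d : ℕ} (s : Multiset (UnitBall d)) : Submodule ℂ (DruryArveson d) :=
  Submodule.span ℂ (kernelVec '' {x | x ∈ s})

instance {d : ℕ} (s : Multiset (UnitBall d)) : FiniteDimensional ℂ (kernelSpan s) :=
  FiniteDimensional.span_of_finite ℂ ((Multiset.finite_toSet s).image _)

/-- The orthogonal projection onto the span of the kernel functions of the points of `s`. -/
def kernelProj {d : ℕ} (s : Multiset (UnitBall d)) : DruryArveson d →L[ℂ] DruryArveson d :=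
  (kernelSpan s).starProjection

theorem kernelVec_mem_kernelSpan {d : ℕ} {s : Multiset (UnitBall d)} {x : UnitBall d}
    (hx : x ∈ s) : kernelVec x ∈ kernelSpan s :=
  Submodule.subset_span ⟨x, hx, rfl⟩

theorem kernelProj_zero {d : ℕ} : kernelProj (0 : Multiset (UnitBall d)) = 0 := by
  refine ContinuousLinearMap.ext fun f => ?_
  have h : kernelSpan (0 : Multiset (UnitBall d)) = ⊥ := by simp [kernelSpan]
  have h1 : kernelProj (0 : Multiset (UnitBall d)) f ∈ kernelSpan (0 : Multiset (UnitBall d)) :=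
    Submodule.starProjection_apply_mem _ _
  rw [h, Submodule.mem_bot] at h1
  rw [h1, zero_apply]

theorem kernelProj_comp_self {d : ℕ} (s : Multiset (UnitBall d)) :
    kernelProj s ∘L kernelProj s = kernelProj s :=
  Submodule.isIdempotentElem_starProjection _

theorem adjoint_kernelProj {d : ℕ} (s : Multiset (UnitBall d)) :
    ContinuousLinearMap.adjoint (kernelProj s) = kernelProj s :=
  isSelfAdjoint_starProjection _

theorem range_kernelProj {d : ℕ} (s : Multiset (UnitBall d)) :
    (kernelProj s : DruryArveson d →ₗ[ℂ] DruryArveson d).range = kernelSpan s :=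
  Submodule.range_starProjection _

theorem inner_kernelProj {d : ℕ} (s : Multiset (UnitBall d)) (f g : DruryArveson d) :
    ⟪f, kernelProj s g⟫_ℂ = ⟪kernelProj s f, g⟫_ℂ := by
  rw [← ContinuousLinearMap.adjoint_inner_left, adjoint_kernelProj]

theorem kernelProj_cons {d : ℕ} (a : UnitBall d) (s : Multiset (UnitBall d))
    (f : DruryArveson d) :
    kernelProj (a ::ₘ s) f = kernelProj s f
      + (⟪kernelVec a - kernelProj s (kernelVec a), f⟫_ℂ /
          (‖kernelVec a - kernelProj s (kernelVec a)‖ : ℂ) ^ 2) •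
            (kernelVec a - kernelProj s (kernelVec a)) := by
  have hS : kernelVec '' {x | x ∈ a ::ₘ s} = insert (kernelVec a) (kernelVec '' {x | x ∈ s}) := by
    rw [← Set.image_insert_eq]
    congr 1
    ext x
    simp
  have e : kernelSpan (a ::ₘ s)
      = Submodule.span ℂ (insert (kernelVec a) (kernelVec '' {x | x ∈ s})) := by
    rw [kernelSpan, hS]
  have : FiniteDimensional ℂ (Submodule.span ℂ (kernelVec '' {x | x ∈ s})) :=
    inferInstanceAs (FiniteDimensional ℂ (kernelSpan s))
  have : FiniteDimensional ℂ
      (Submodule.span ℂ (insert (kernelVec a) (kernelVec '' {x | x ∈ s}))) := by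
    rw [← e]; infer_instance
  have h := starProjection_span_insert (kernelVec a) (kernelVec '' {x | x ∈ s}) f
  have h2 : kernelProj (a ::ₘ s) f
      = (Submodule.span ℂ (insert (kernelVec a) (kernelVec '' {x | x ∈ s}))).starProjection f := by
    simp only [kernelProj, e]
  rw [h2, h]
  rfl

/-! ### The kernel of a Blaschke row -/

/-- Since `U U^* = 1`, right multiplication by `U` does not change the kernel `b(z) b(w)^*` of a
row. -/
theorem sum_conj_vecMul_unitary {k : ℕ} {U : Matrix (Fin k) (Fin k) ℂ}
    (hU : U ∈ Matrix.unitaryGroup (Fin k) ℂ) (v w : EuclideanSpace ℂ (Fin k)) :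
    ∑ i, (starRingEnd ℂ) (Matrix.vecMul w.ofLp U i) * Matrix.vecMul v.ofLp U i = ⟪w, v⟫_ℂ := by
  have h1 : ∑ i, (starRingEnd ℂ) (Matrix.vecMul w.ofLp U i) * Matrix.vecMul v.ofLp U i
      = (Matrix.vecMul v.ofLp U) ⬝ᵥ star (Matrix.vecMul w.ofLp U) := by
    simp [dotProduct, mul_comm]
  rw [h1, Matrix.star_vecMul, Matrix.dotProduct_mulVec, Matrix.vecMul_vecMul,
    ← Matrix.star_eq_conjTranspose, Matrix.mem_unitaryGroup_iff.1 hU, Matrix.vecMul_one,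
    inner_eq_sum_conj_mul]
  simp [dotProduct, mul_comm]

/-- Of the entries of `b U`, only the first is altered by the diagonal factor, where it is
multiplied by the row `φ_lam`. -/
theorem inner_blaschkeStep {d k : ℕ} (b : UnitBall d → EuclideanSpace ℂ (Fin (k + 1)))
    {U : Matrix (Fin (k + 1)) (Fin (k + 1)) ℂ} (hU : U ∈ Matrix.unitaryGroup (Fin (k + 1)) ℂ)
    (lam z w : UnitBall d) :
    ⟪blaschkeStep b U lam w, blaschkeStep b U lam z⟫_ℂ = ⟪b w, b z⟫_ℂ -
      (starRingEnd ℂ) (Matrix.vecMul (b w).ofLp U 0) * Matrix.vecMul (b z).ofLp U 0 *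
        (1 - ⟪ballInvolution (lam : EuclideanSpace ℂ (Fin d)) w,
          ballInvolution (lam : EuclideanSpace ℂ (Fin d)) z⟫_ℂ) := by
  rw [← sum_conj_vecMul_unitary hU, Fin.sum_univ_succ, inner_eq_sum_conj_mul, Fin.sum_univ_add,
    inner_eq_sum_conj_mul (ballInvolution _ _), mul_sub, Finset.mul_sum]
  simp only [blaschkeStep, Fin.append_left, Fin.append_right, map_mul]
  have : ∀ i : Fin d, (starRingEnd ℂ) (Matrix.vecMul (b w).ofLp U 0) *
        (starRingEnd ℂ) (ballInvolution (lam : EuclideanSpace ℂ (Fin d)) w i) *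
      (Matrix.vecMul (b z).ofLp U 0 * ballInvolution (lam : EuclideanSpace ℂ (Fin d)) z i)
      = (starRingEnd ℂ) (Matrix.vecMul (b w).ofLp U 0) * Matrix.vecMul (b z).ofLp U 0 *
        ((starRingEnd ℂ) (ballInvolution (lam : EuclideanSpace ℂ (Fin d)) w i) *
          ballInvolution (lam : EuclideanSpace ℂ (Fin d)) z i) := fun i => by ring
  simp only [this]
  ring

/-- Both sides follow the same recursion. With `u = (I - P) k_lam`, the inductive hypothesis reads
`b(z) b(lam)^* k(z, lam) = u(z)`, so the term lost in a Blaschke step is `u(z) conj(u(w)) / ‖u‖ ^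
2`, which is the Gram-Schmidt correction in `kernelProj_cons`. -/
theorem IsBlaschkeRow.inner_mul_kernel {d : ℕ} {l : List (UnitBall d)} {N : ℕ}
    {b : UnitBall d → EuclideanSpace ℂ (Fin N)} (h : IsBlaschkeRow l N b) (z w : UnitBall d) :
    ⟪b w, b z⟫_ℂ * ⟪kernelVec z, kernelVec w⟫_ℂ
      = ⟪kernelVec z, kernelVec w - kernelProj (l : Multiset (UnitBall d)) (kernelVec w)⟫_ℂ := by
  induction h generalizing z w with
  | single lam =>
    have h := rankOne_involution_kernel lam z w
    rw [show (([lam] : List (UnitBall d)) : Multiset (UnitBall d)) = lam ::ₘ 0 from rfl,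
      kernelProj_cons, kernelProj_zero]
    simp only [zero_apply, sub_zero, zero_add, inner_sub_right,
      inner_smul_right]
    rw [inner_self_eq_norm_sq_to_K] at h
    linear_combination -h
  | @step l k b lam U hb hU hU0 ih =>
    -- If the norm were zero, division by zero would make the first column of `U` zero,
    -- contradicting unitarity.
    have hb0 : (‖b lam‖ : ℂ) ≠ 0 := by
      intro h0
      have h1 := congrFun (congrFun (Matrix.mem_unitaryGroup_iff'.1 hU) 0) 0
      simp [Matrix.mul_apply, hU0, h0] at h1
    have hc : ∀ x, Matrix.vecMul (b x).ofLp U 0 = ⟪b lam, b x⟫_ℂ / ‖b lam‖ := by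
      intro x
      rw [inner_eq_sum_conj_mul, Finset.sum_div]
      simp only [Matrix.vecMul, dotProduct, hU0]
      exact Finset.sum_congr rfl fun i _ => by ring
    have hlist : ((l ++ [lam] : List (UnitBall d)) : Multiset (UnitBall d))
        = lam ::ₘ (l : Multiset (UnitBall d)) :=
      Multiset.coe_eq_coe.2 (List.perm_append_singleton _ _)
    rw [hlist, kernelProj_cons, inner_blaschkeStep b hU, hc, hc, sub_mul, ih, mul_assoc,
      rankOne_involution_kernel]
    set u := kernelVec lam - kernelProj (l : Multiset (UnitBall d)) (kernelVec lam) with hu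
    have h1 : ⟪kernelVec z, u⟫_ℂ = ⟪b lam, b z⟫_ℂ * ⟪kernelVec z, kernelVec lam⟫_ℂ := (ih z lam).symm
    have h2 : ⟪u, kernelVec w⟫_ℂ = ⟪b w, b lam⟫_ℂ * ⟪kernelVec lam, kernelVec w⟫_ℂ := by
      rw [ih lam w, hu, inner_sub_left, inner_sub_right, inner_kernelProj]
    -- As `I - P` is a projection, `‖u‖ ^ 2 = ⟨k_lam, u⟩`, which the inductive hypothesis evaluates
    -- at `z = w = lam`.
    have h3 : (‖u‖ : ℂ) ^ 2 = (‖b lam‖ : ℂ) ^ 2 * ⟪kernelVec lam, kernelVec lam⟫_ℂ := by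
      have e := ih lam lam
      rw [inner_self_eq_norm_sq_to_K] at e
      refine Eq.trans ?_ e.symm
      have hpu : kernelProj (l : Multiset (UnitBall d)) u = 0 := by
        rw [hu, map_sub, ← ContinuousLinearMap.comp_apply, kernelProj_comp_self, sub_self]
      rw [← hu, show ((‖u‖ : ℂ)) ^ 2 = ⟪u, u⟫_ℂ from (inner_self_eq_norm_sq_to_K u).symm]
      conv_lhs => rw [hu, inner_sub_left, ← hu, ← inner_kernelProj, hpu, inner_zero_right, sub_zero]
    have hk : ⟪kernelVec lam, kernelVec lam⟫_ℂ ≠ 0 := inner_self_ne_zero.2 (kernelVec_ne_zero lam)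
    rw [← sub_sub, inner_sub_right _ _ ((_ : ℂ) • u), inner_smul_right, h1, h2, h3, map_div₀,
      inner_conj_symm, Complex.conj_ofReal]
    field_simp

/-- The multiplication operator of a Blaschke row. -/
theorem IsBlaschkeRow.exists_mulOp {d : ℕ} {l : List (UnitBall d)} {N : ℕ}
    {b : UnitBall d → EuclideanSpace ℂ (Fin N)} (h : IsBlaschkeRow l N b) :
    ∃ M : PiLp 2 (fun _ : Fin N => DruryArveson d) →L[ℂ] DruryArveson d,
      IsRowMultiplicationOp b M ∧ M ∘L ContinuousLinearMap.adjoint M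
        = ContinuousLinearMap.id ℂ (DruryArveson d) - kernelProj (l : Multiset (UnitBall d)) := by
  refine exists_isRowMultiplicationOp b _ ?_ ?_ fun z w => ?_
  · ext1 f
    have := congrArg (fun T => T f) (kernelProj_comp_self (l : Multiset (UnitBall d)))
    simp only [ContinuousLinearMap.comp_apply] at this
    simp [this]
  · rw [map_sub, adjoint_kernelProj, ContinuousLinearMap.adjoint_id]
  · rw [h.inner_mul_kernel z w]
    rfl

/-! ### Partial isometries -/

section PartialIsometry

variable {E F : Type*} [NormedAddCommGroup E] [InnerProductSpace ℂ E] [CompleteSpace E]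
  [NormedAddCommGroup F] [InnerProductSpace ℂ F] [CompleteSpace F]

/-- For `D = M M^* M - M`, the operator `D D^*` is a polynomial in `M M^*` that vanishes for an
idempotent; and `D D^* = 0` forces `D = 0`. -/
theorem comp_adjoint_comp_self_of_idempotent (M : E →L[ℂ] F)
    (h : (M ∘L ContinuousLinearMap.adjoint M) ∘L (M ∘L ContinuousLinearMap.adjoint M)
      = M ∘L ContinuousLinearMap.adjoint M) :
    M ∘L ContinuousLinearMap.adjoint M ∘L M = M := by
  set A := ContinuousLinearMap.adjoint M with hA
  set D := M ∘L A ∘L M - M with hD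
  have hDD : D ∘L ContinuousLinearMap.adjoint D = 0 := by
    have hDa : ContinuousLinearMap.adjoint D = A ∘L M ∘L A - A := by
      rw [hD, map_sub, ContinuousLinearMap.adjoint_comp, ContinuousLinearMap.adjoint_comp, hA,
        ContinuousLinearMap.adjoint_adjoint, ContinuousLinearMap.comp_assoc]
    rw [hDa, hD]
    ext1 f
    have h' : ∀ f, M (A (M (A f))) = M (A f) := fun f => congrArg (fun T => T f) h
    simp [h']
  have h0 : ContinuousLinearMap.adjoint D = 0 := by
    ext1 f
    have : ⟪ContinuousLinearMap.adjoint D f, ContinuousLinearMap.adjoint D f⟫_ℂ = 0 := by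
      rw [← ContinuousLinearMap.adjoint_inner_right, ContinuousLinearMap.adjoint_adjoint,
        ← ContinuousLinearMap.comp_apply, hDD]
      simp
    simpa using this
  have : D = 0 := by
    rw [← ContinuousLinearMap.adjoint_adjoint D, h0, map_zero]
  exact sub_eq_zero.1 this

end PartialIsometry

/-! ### Coordinate multiplications -/

theorem isMultiplicationOp_mulOp {d : ℕ} {f : UnitBall d → ℂ} (h : f ∈ multiplierAlgebra d) :
    IsMultiplicationOp f (mulOp f) := by
  have h' : ∃ T, IsMultiplicationOp f T := h
  rw [mulOp, dif_pos h']
  exact h'.choose_spec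

theorem IsMultiplicationOp.adjoint_kernelVec {d : ℕ} {f : UnitBall d → ℂ}
    {T : DruryArveson d →L[ℂ] DruryArveson d} (h : IsMultiplicationOp f T) (z : UnitBall d) :
    ContinuousLinearMap.adjoint T (kernelVec z) = (starRingEnd ℂ) (f z) • kernelVec z := by
  refine ext_inner_right ℂ fun g => ?_
  rw [ContinuousLinearMap.adjoint_inner_left, ← apply_eq_inner, h g z, inner_smul_left,
    Complex.conj_conj, apply_eq_inner]

/-- The Blaschke row of the single point `0` is `φ_0(z) = -z`, already known to be a bounded row
multiplier; its `j`-th entry, with the sign changed, is the coordinate. -/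
theorem coord_mem_multiplierAlgebra {d : ℕ} (j : Fin d) :
    (fun z : UnitBall d => (z : EuclideanSpace ℂ (Fin d)) j) ∈ multiplierAlgebra d := by
  obtain ⟨M, hM, -⟩ := (IsBlaschkeRow.single (⟨0, by simp⟩ : UnitBall d)).exists_mulOp
  let ι : DruryArveson d →L[ℂ] PiLp 2 (fun _ : Fin d => DruryArveson d) :=
    (PiLp.continuousLinearEquiv 2 ℂ (fun _ : Fin d => DruryArveson d)).symm.toContinuousLinearMap ∘L
      ContinuousLinearMap.single ℂ (fun _ : Fin d => DruryArveson d) j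
  refine ⟨-(M ∘L ι), fun g z => ?_⟩
  rw [neg_apply, RKHS.coe_neg (𝕜 := ℂ), Pi.neg_apply,
    ContinuousLinearMap.comp_apply, hM, Finset.sum_eq_single j]
  · have : (ι g) j = g := by simp [ι]
    rw [this]
    simp [ballInvolution, lineProj]
  · intro i _ hi
    have : (ι g) i = 0 := by simp [ι, hi]
    rw [this]
    simp [RKHS.coe_zero (𝕜 := ℂ)]
  · simp

theorem coordShift_apply {d : ℕ} (j : Fin d) (g : DruryArveson d) (z : UnitBall d) :
    coordShift j g z = (z : EuclideanSpace ℂ (Fin d)) j * g z :=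
  isMultiplicationOp_mulOp (coord_mem_multiplierAlgebra j) g z

/-! ### Polynomial interpolation and independence of kernel functions -/

/-- The multiplier `⟨z - y, x - y⟩` vanishes at `y` and equals `‖x - y‖ ^ 2` at `x`. Its norm is
bounded uniformly in `x` and `y` because the coordinates of `x - y` are at most `2` and those of `y`
at most `1` in modulus. -/
theorem exists_mulOp_inner_sub (d : ℕ) : ∃ C : ℝ, 0 ≤ C ∧ ∀ x y : UnitBall d,
    ∃ T : DruryArveson d →L[ℂ] DruryArveson d, ‖T‖ ≤ C ∧ ∀ (g : DruryArveson d) (z : UnitBall d),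
      T g z = ⟪(x - y : EuclideanSpace ℂ (Fin d)), z - y⟫_ℂ * g z := by
  refine ⟨∑ j : Fin d, 2 * (‖coordShift j‖ + 1), by positivity, fun x y => ?_⟩
  refine ⟨∑ j : Fin d, (starRingEnd ℂ) ((x - y : EuclideanSpace ℂ (Fin d)) j) •
    (coordShift j - (y : EuclideanSpace ℂ (Fin d)) j • ContinuousLinearMap.id ℂ _), ?_, ?_⟩
  · refine (norm_sum_le _ _).trans (Finset.sum_le_sum fun j _ => ?_)
    have hx := norm_coe_lt_one x
    have hy := norm_coe_lt_one y
    have h1 : ‖(x - y : EuclideanSpace ℂ (Fin d)) j‖ ≤ 2 :=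
      (PiLp.norm_apply_le _ j).trans ((norm_sub_le _ _).trans (by linarith))
    have h2 : ‖(y : EuclideanSpace ℂ (Fin d)) j‖ ≤ 1 := (PiLp.norm_apply_le _ j).trans hy.le
    rw [norm_smul, RCLike.norm_conj]
    refine mul_le_mul h1 ((norm_sub_le _ _).trans ?_) (norm_nonneg _) zero_le_two
    rw [norm_smul]
    have h3 := ContinuousLinearMap.norm_id_le (𝕜 := ℂ) (E := DruryArveson d)
    gcongr
    nlinarith [norm_nonneg (ContinuousLinearMap.id ℂ (DruryArveson d)),
      norm_nonneg ((y : EuclideanSpace ℂ (Fin d)) j)]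
  · intro g z
    rw [apply_eq_inner, inner_eq_sum_conj_mul, Finset.sum_mul, sum_apply,
      inner_sum]
    refine Finset.sum_congr rfl fun j _ => ?_
    have h := coordShift_apply j g z
    rw [apply_eq_inner, apply_eq_inner] at h
    simp only [smul_apply, sub_apply,
      ContinuousLinearMap.id_apply, inner_smul_right, inner_sub_right, h, PiLp.sub_apply,
      apply_eq_inner]
    ring

/-- Functions with prescribed zeros, with a bound on their norms that depends only on the number of
zeros. -/
theorem exists_interpolant (d n : ℕ) : ∃ C : ℝ, 0 ≤ C ∧ ∀ (x : UnitBall d)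
    (s : Multiset (UnitBall d)), Multiset.card s = n → ∃ f : DruryArveson d, ‖f‖ ≤ C ∧
      (∀ y ∈ s, f y = 0) ∧
      f x = (((s.map fun y : UnitBall d => ‖(x - y : EuclideanSpace ℂ (Fin d))‖ ^ 2).prod : ℝ) : ℂ) := by
  obtain ⟨C, hC, hT⟩ := exists_mulOp_inner_sub d
  set o : UnitBall d := ⟨0, by simp⟩ with ho
  -- The function is the constant `1 = k_0` multiplied by one factor from `hT` for each zero.
  refine ⟨C ^ n * ‖kernelVec o‖, by positivity, fun x s => ?_⟩
  induction s using Multiset.induction generalizing n with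
  | empty =>
    rintro rfl
    refine ⟨kernelVec o, by simp, by simp, ?_⟩
    rw [apply_eq_inner, inner_kernelVec]
    simp [ho]
  | cons y s ih =>
    intro hn
    obtain ⟨f, hf, hf0, hfx⟩ := ih (Multiset.card s) rfl
    obtain ⟨T, hTn, hTa⟩ := hT x y
    refine ⟨T f, ?_, ?_, ?_⟩
    · rw [← hn, Multiset.card_cons, pow_succ, mul_comm _ C, mul_assoc]
      exact (T.le_opNorm f).trans (mul_le_mul hTn hf (norm_nonneg _) hC)
    · intro w hw
      rw [hTa]
      rcases Multiset.mem_cons.1 hw with rfl | hw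
      · simp
      · rw [hf0 w hw, mul_zero]
    · rw [hTa, hfx, inner_self_eq_norm_sq_to_K]
      simp

/-- The interpolant vanishing on `s` is orthogonal to `kernelSpan s`, but its value at `x` is a
product of nonzero squared distances. -/
theorem kernelVec_notMem_kernelSpan {d : ℕ} {s : Multiset (UnitBall d)} {x : UnitBall d}
    (hx : x ∉ s) : kernelVec x ∉ kernelSpan s := by
  intro h
  obtain ⟨C, -, hC⟩ := exists_interpolant d (Multiset.card s)
  obtain ⟨f, -, hf0, hfx⟩ := hC x s rfl
  have h0 : ∀ v ∈ kernelSpan s, ⟪v, f⟫_ℂ = 0 := by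
    intro v hv
    refine Submodule.span_induction (p := fun v _ => ⟪v, f⟫_ℂ = 0) ?_ (by simp) ?_ ?_ hv
    · rintro _ ⟨y, hy, rfl⟩
      exact hf0 y hy
    · intro a b _ _ ha hb
      rw [inner_add_left, ha, hb, add_zero]
    · intro c a _ ha
      rw [inner_smul_left, ha, mul_zero]
  have h1 := h0 _ h
  rw [← apply_eq_inner, hfx] at h1
  have h2 : (0 : ℝ) ∈ s.map fun y : UnitBall d => ‖(x - y : EuclideanSpace ℂ (Fin d))‖ ^ 2 :=
    Multiset.prod_eq_zero_iff.1 (by exact_mod_cast h1)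
  obtain ⟨y, hy, hxy⟩ := Multiset.mem_map.1 h2
  have : x = y := Subtype.ext (by simpa [sub_eq_zero] using hxy)
  exact hx (this ▸ hy)

theorem kernelVec_sub_kernelProj_ne_zero {d : ℕ} {s : Multiset (UnitBall d)} {x : UnitBall d}
    (hx : x ∉ s) : kernelVec x - kernelProj s (kernelVec x) ≠ 0 := by
  intro h
  refine kernelVec_notMem_kernelSpan hx (Submodule.starProjection_eq_self_iff.1 ?_)
  exact (sub_eq_zero.1 h).symm

theorem linearIndependent_kernelVec {d : ℕ} : LinearIndependent ℂ (kernelVec (d := d)) := by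
  rw [linearIndependent_iff_finset_linearIndependent]
  intro t
  rw [linearIndependent_iff_notMem_span]
  intro i hi
  classical
  refine kernelVec_notMem_kernelSpan (s := (t.erase i).val) (x := i)
    (Finset.notMem_erase _ _) ?_
  refine Submodule.span_mono ?_ hi
  rintro _ ⟨j, hj, rfl⟩
  exact ⟨j, Finset.mem_erase.2 ⟨fun h => hj.2 (Subtype.ext h), j.2⟩, rfl⟩

theorem finrank_kernelSpan {d : ℕ} {s : Multiset (UnitBall d)} (hs : s.Nodup) :
    Module.finrank ℂ (kernelSpan s) = Multiset.card s := by
  classical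
  have h := finrank_span_eq_card (linearIndependent_kernelVec.comp
    (fun x : (⟨s, hs⟩ : Finset (UnitBall d)) => (x : UnitBall d)) Subtype.val_injective)
  rw [Fintype.card_coe] at h
  have e : kernelVec '' {x | x ∈ s} = Set.range (kernelVec ∘
      fun x : (⟨s, hs⟩ : Finset (UnitBall d)) => (x : UnitBall d)) := by
    ext v
    constructor
    · rintro ⟨x, hx, rfl⟩
      exact ⟨⟨x, hx⟩, rfl⟩
    · rintro ⟨x, rfl⟩
      exact ⟨x, x.2, rfl⟩
  rw [kernelSpan, e, h]
  rfl

/-! ### Existence of Blaschke rows -/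

theorem exists_unitary_first_column {k : ℕ} (v : EuclideanSpace ℂ (Fin (k + 1))) (hv : ‖v‖ = 1) :
    ∃ U ∈ Matrix.unitaryGroup (Fin (k + 1)) ℂ, ∀ i, U i 0 = v i := by
  obtain ⟨B, hB⟩ := Orthonormal.exists_orthonormalBasis_extension_of_card_eq (𝕜 := ℂ)
    (E := EuclideanSpace ℂ (Fin (k + 1))) (ι := Fin (k + 1)) (by simp) (v := fun _ => v)
    (s := {0}) ⟨fun _ => hv, fun i j hij => absurd (Subsingleton.elim i j) hij⟩
  refine ⟨(EuclideanSpace.basisFun (Fin (k + 1)) ℂ).toBasis.toMatrix B,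
    OrthonormalBasis.toMatrix_orthonormalBasis_mem_unitary _ _, fun i => ?_⟩
  rw [Module.Basis.toMatrix_apply, hB 0 rfl]
  simp

/-- The only obstruction to a further step is `b a = 0`. This cannot happen at a new point, since
`‖b a‖ ^ 2 k(a, a)` is the squared norm of `(I - P) k_a`, which is nonzero by independence of kernel
functions. -/
theorem exists_isBlaschkeRow {d : ℕ} (hd : 0 < d) (l : List (UnitBall d)) (hl : l.Nodup)
    (hl0 : l ≠ []) :
    ∃ b : UnitBall d → EuclideanSpace ℂ (Fin ((l.length - 1) * (d - 1) + d)),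
      IsBlaschkeRow l ((l.length - 1) * (d - 1) + d) b := by
  induction l using List.reverseRecOn with
  | nil => exact absurd rfl hl0
  | append_singleton l a ih =>
    by_cases h : l = []
    · subst h
      have : (([] ++ [a] : List (UnitBall d)).length - 1) * (d - 1) + d = d := by simp
      rw [this]
      exact ⟨_, IsBlaschkeRow.single a⟩
    have hla := List.nodup_append.1 hl
    obtain ⟨b, hb⟩ := ih hla.1 h
    have hlen : 0 < l.length := List.length_pos_iff.2 h
    -- The step needs a row of size written as `k + 1` and returns one of size `d + k`; `0 < d`
    -- makes the truncated subtractions agree.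
    set k := (l.length - 1) * (d - 1) + (d - 1) with hk
    have e1 : (l.length - 1) * (d - 1) + d = k + 1 := by omega
    have e2 : ((l ++ [a]).length - 1) * (d - 1) + d = d + k := by
      obtain ⟨m, hm⟩ : ∃ m, l.length = m + 1 := ⟨l.length - 1, by omega⟩
      simp only [hk, List.length_append, hm, List.length_singleton, Nat.add_sub_cancel]
      ring
    rw [e2]
    revert b
    rw [e1]
    intro b hb
    have hba : b a ≠ 0 := by
      intro h0
      have hal : a ∉ (l : Multiset (UnitBall d)) := fun hm => hla.2.2 a hm a (by simp) rfl
      have h1 := hb.inner_mul_kernel a a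
      rw [h0, inner_zero_left, zero_mul] at h1
      refine kernelVec_sub_kernelProj_ne_zero hal ?_
      set u := kernelVec a - kernelProj (l : Multiset (UnitBall d)) (kernelVec a) with hu
      have hpu : kernelProj (l : Multiset (UnitBall d)) u = 0 := by
        rw [hu, map_sub, ← ContinuousLinearMap.comp_apply, kernelProj_comp_self, sub_self]
      have : ⟪u, u⟫_ℂ = 0 := by
        conv_lhs => rw [hu, inner_sub_left, ← hu, ← inner_kernelProj, hpu, inner_zero_right,
          sub_zero]
        exact h1.symm
      exact inner_self_eq_zero.1 this
    have hn : (‖b a‖ : ℂ) ≠ 0 := by simpa using hba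
    obtain ⟨U, hU, hU0⟩ := exists_unitary_first_column
      (WithLp.toLp 2 fun i => (starRingEnd ℂ) (b a i) / (‖b a‖ : ℂ)) (by
        rw [← pow_left_inj₀ (norm_nonneg _) zero_le_one two_ne_zero, EuclideanSpace.norm_sq_eq]
        simp only [norm_div, RCLike.norm_conj, div_pow, Complex.norm_real, norm_norm]
        rw [← Finset.sum_div, ← EuclideanSpace.norm_sq_eq]
        field_simp)
    exact ⟨_, IsBlaschkeRow.step a U hb hU hU0⟩

/-! ### Continuity of the projections -/

theorem kernelProj_cons' {d : ℕ} (a : UnitBall d) (s : Multiset (UnitBall d)) :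
    kernelProj (a ::ₘ s) = kernelProj s
      + ((‖kernelVec a - kernelProj s (kernelVec a)‖ : ℂ) ^ 2)⁻¹ •
        (innerSL ℂ (kernelVec a - kernelProj s (kernelVec a))).smulRight
          (kernelVec a - kernelProj s (kernelVec a)) := by
  ext1 f
  rw [kernelProj_cons]
  simp [smul_smul, div_eq_inv_mul]

theorem continuousAt_inv_smul_smulRight {X H : Type*} [TopologicalSpace X]
    [NormedAddCommGroup H] [InnerProductSpace ℂ H] {u : X → H} {x : X} (hu : ContinuousAt u x)
    (h0 : u x ≠ 0) :
    ContinuousAt (fun y => ((‖u y‖ : ℂ) ^ 2)⁻¹ • (innerSL ℂ (u y)).smulRight (u y)) x := by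
  have h1 : ContinuousAt (fun y => (‖u y‖ : ℂ) ^ 2) x :=
    (Complex.continuous_ofReal.continuousAt.comp hu.norm).pow 2
  have h2 : ContinuousAt (fun y => ((‖u y‖ : ℂ) ^ 2)⁻¹) x := h1.inv₀ (by simpa using h0)
  have h3 : ContinuousAt (fun y => innerSL ℂ (u y)) x :=
    (innerSL ℂ (E := H)).continuous.continuousAt.comp hu
  have h4 : ContinuousAt (fun y => (innerSL ℂ (u y)).smulRight (u y)) x :=
    ((ContinuousLinearMap.smulRightL ℂ H H).continuous.continuousAt.comp h3).clm_apply hu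
  exact h2.smul h4

/-- Induction by Gram-Schmidt: each point adds a rank one projection onto a residual vector. This is
continuous where the residual is nonzero, which distinctness of the points of `x` ensures; the
neighbouring tuples need not be injective. -/
theorem continuousAt_kernelProj_ofFn {d n : ℕ} (x : Fin n → UnitBall d)
    (hx : Function.Injective x) :
    ContinuousAt (fun y : Fin n → UnitBall d =>
      kernelProj ((List.ofFn y : List (UnitBall d)) : Multiset (UnitBall d))) x := by
  induction n with
  | zero => exact (continuous_of_const fun a b => by rw [Subsingleton.elim a b]).continuousAt
  | succ n ih =>
    have e : ∀ y : Fin (n + 1) → UnitBall d,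
        ((List.ofFn y : List (UnitBall d)) : Multiset (UnitBall d))
          = y 0 ::ₘ ((List.ofFn fun i : Fin n => y i.succ : List (UnitBall d)) : Multiset _) := by
      intro y
      rw [List.ofFn_succ, Multiset.cons_coe]
    simp_rw [e, kernelProj_cons']
    have hg : Continuous fun (y : Fin (n + 1) → UnitBall d) (i : Fin n) => y i.succ :=
      continuous_pi fun i => continuous_apply _
    have h1 : ContinuousAt (fun y : Fin (n + 1) → UnitBall d => kernelProj
        ((List.ofFn fun i : Fin n => y i.succ : List (UnitBall d)) : Multiset (UnitBall d))) x := by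
      have h0 := ih (fun i => x i.succ) fun i j h => Fin.succ_injective _ (hx h)
      have h0' := h0.tendsto.comp (hg.tendsto x)
      exact h0'
    have h2 : ContinuousAt (fun y : Fin (n + 1) → UnitBall d => kernelVec (y 0)) x := by
      have : Continuous fun y : Fin (n + 1) → UnitBall d => kernelVec (y 0) :=
        continuous_kernelVec.comp (by fun_prop)
      exact this.continuousAt
    refine h1.add (continuousAt_inv_smul_smulRight (h2.sub (h1.clm_apply h2)) ?_)
    have : x 0 ∉ ((List.ofFn fun i : Fin n => x i.succ : List (UnitBall d)) : Multiset _) := by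
      rw [Multiset.mem_coe, List.mem_ofFn]
      rintro ⟨i, hi⟩
      exact Fin.succ_ne_zero i (hx hi)
    exact kernelVec_sub_kernelProj_ne_zero this

/-! ### Root subspaces of commuting tuples -/

section JointSpectrum

open Module End

variable {d : ℕ} {V : Type*} [AddCommGroup V] [Module ℂ V]

theorem prod_ofFn_pow_eq_mul_of_comm {M : Type*} [CommMonoid M] (n : Fin d → M) (α : Fin d → ℕ)
    (i : Fin d) (hi : 0 < α i) :
    (List.ofFn fun j => n j ^ α j).prod
      = (List.ofFn fun j => n j ^ (Function.update α i (α i - 1) j)).prod * n i := by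
  rw [List.prod_ofFn, List.prod_ofFn, ← Finset.mul_prod_erase _ _ (Finset.mem_univ i),
    ← Finset.mul_prod_erase _ _ (Finset.mem_univ i)]
  have h1 : ∏ x ∈ Finset.univ.erase i, n x ^ Function.update α i (α i - 1) x
      = ∏ x ∈ Finset.univ.erase i, n x ^ α x :=
    Finset.prod_congr rfl fun x hx => by
      rw [Function.update_of_ne (Finset.ne_of_mem_erase hx)]
  rw [h1, Function.update_self, mul_right_comm, ← pow_succ, Nat.sub_add_cancel hi]

/-- One factor of a monomial in commuting endomorphisms may be split off on the right. -/
theorem prod_ofFn_pow_eq_mul (N : Fin d → Module.End ℂ V) (hN : ∀ i j, Commute (N i) (N j))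
    (α : Fin d → ℕ) (i : Fin d) (hi : 0 < α i) :
    (List.ofFn fun j => N j ^ α j).prod
      = (List.ofFn fun j => N j ^ (Function.update α i (α i - 1) j)).prod * N i := by
  -- The identity is proved in the commutative subalgebra generated by the `N j` and then pushed
  -- forward.
  have : IsMulCommutative (Algebra.adjoin ℂ (Set.range N)) :=
    Algebra.isMulCommutative_adjoin ℂ (by rintro _ ⟨a, rfl⟩ _ ⟨b, rfl⟩; exact hN a b)
  let _ : CommMonoid (Algebra.adjoin ℂ (Set.range N)) :=
    { (inferInstance : Monoid (Algebra.adjoin ℂ (Set.range N))) with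
      mul_comm := this.is_comm.comm }
  let n : Fin d → Algebra.adjoin ℂ (Set.range N) := fun j =>
    ⟨N j, Algebra.subset_adjoin ⟨j, rfl⟩⟩
  have key : (List.ofFn fun j => n j ^ α j).prod
      = (List.ofFn fun j => n j ^ (Function.update α i (α i - 1) j)).prod * n i :=
    prod_ofFn_pow_eq_mul_of_comm n α i hi
  have h2 := congrArg (Algebra.adjoin ℂ (Set.range N)).val key
  rw [map_mul, map_list_prod, map_list_prod, List.map_ofFn, List.map_ofFn] at h2
  exact h2

theorem sum_update_pred (α : Fin d → ℕ) (i : Fin d) (hi : 0 < α i) (m : ℕ)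
    (h : ∑ j, α j = m + 1) : ∑ j, Function.update α i (α i - 1) j = m := by
  rw [Finset.sum_update_of_mem (Finset.mem_univ i)]
  rw [← Finset.add_sum_erase _ _ (Finset.mem_univ i), Finset.erase_eq] at h
  omega

theorem prod_ofFn_pow_single (N : Fin d → Module.End ℂ V) (hN : ∀ i j, Commute (N i) (N j))
    (i : Fin d) (m : ℕ) :
    (List.ofFn fun j => N j ^ (Pi.single i m : Fin d → ℕ) j).prod = N i ^ m := by
  induction m with
  | zero => simp
  | succ m ih =>
    rw [prod_ofFn_pow_eq_mul N hN _ i (by simp), pow_succ, ← ih]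
    simp [Pi.single]

/-- A subspace invariant under commuting endomorphisms that are nilpotent on it is annihilated by
all monomials of degree at least its dimension. -/
theorem le_ker_prod_of_nilpotent [FiniteDimensional ℂ V] (N : Fin d → Module.End ℂ V) (hN : ∀ i j, Commute (N i) (N j))
    (m : ℕ) (W : Submodule ℂ V) (hW : ∀ j, ∀ w ∈ W, N j w ∈ W)
    (hnil : ∀ j, ∀ w ∈ W, ∃ k : ℕ, (N j ^ k) w = 0) (hm : finrank ℂ W ≤ m) (α : Fin d → ℕ)
    (hα : ∑ j, α j = m) : W ≤ LinearMap.ker (List.ofFn fun j => N j ^ α j).prod := by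
  induction m generalizing W α with
  | zero =>
    rw [Submodule.finrank_eq_zero.1 (Nat.le_zero.1 hm)]
    exact bot_le
  | succ m ih =>
    obtain ⟨i, hi⟩ : ∃ i, 0 < α i := by
      by_contra! h
      rw [Finset.sum_eq_zero fun j _ => Nat.le_zero.1 (h j)] at hα
      omega
    have hle : W.map (N i) ≤ W := by
      rintro _ ⟨w, hw, rfl⟩
      exact hW i w hw
    by_cases hW0 : W = ⊥
    · rw [hW0]; exact bot_le
    -- A nilpotent map of a nonzero finite-dimensional space is not surjective, so each factor
    -- lowers the dimension by at least one.
    have hlt : W.map (N i) < W := by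
      refine lt_of_le_of_ne hle fun he => hW0 ?_
      have hinj : ∀ w ∈ W, N i w = 0 → w = 0 := by
        let T : W →ₗ[ℂ] W := (N i).restrict (hW i)
        have hsurj : Function.Surjective T := by
          rintro ⟨w, hw⟩
          rw [← he] at hw
          obtain ⟨v, hv, rfl⟩ := hw
          exact ⟨⟨v, hv⟩, rfl⟩
        have := LinearMap.injective_iff_surjective.2 hsurj
        intro w hw h0
        have h1 : T ⟨w, hw⟩ = T 0 := by
          rw [map_zero]
          exact Subtype.ext h0
        exact congrArg Subtype.val (this h1)
      rw [Submodule.eq_bot_iff]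
      intro w hw
      obtain ⟨k, hk⟩ := hnil i w hw
      have hpow : ∀ (k : ℕ), ∀ w ∈ W, (N i ^ k) w = 0 → w = 0 := by
        intro k
        induction k with
        | zero => intro w _ h; simpa using h
        | succ k ihk =>
          intro w hw h
          refine hinj w hw (ihk _ (hW i w hw) ?_)
          rw [pow_succ] at h
          exact h
      exact hpow k w hw hk
    have hlt' := Submodule.finrank_lt_finrank_of_lt hlt
    have h := ih (W.map (N i)) ?_ ?_ (by omega) (Function.update α i (α i - 1))
      (sum_update_pred α i hi m hα)
    · intro w hw
      rw [LinearMap.mem_ker, prod_ofFn_pow_eq_mul N hN α i hi]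
      exact h ⟨w, hw, rfl⟩
    · rintro j _ ⟨w, hw, rfl⟩
      refine ⟨N j w, hW j w hw, ?_⟩
      exact congrArg (fun T => T w) (hN i j).eq
    · rintro j w hw
      exact hnil j w (hle hw)

theorem commute_sub_smul {A : Fin d → Module.End ℂ V} (hA : ∀ i j, Commute (A i) (A j))
    (c : Fin d → ℂ) (i j : Fin d) :
    Commute (A i - c i • (1 : Module.End ℂ V)) (A j - c j • (1 : Module.End ℂ V)) :=
  ((hA i j).sub_right ((Commute.one_right _).smul_right _)).sub_left
    (((Commute.one_left _).smul_left _))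

/-- Taking `α` concentrated in one coordinate gives one inclusion. For the other, the joint
generalized eigenspace is invariant and `A - λ` is nilpotent on it, so monomials of degree equal to
the dimension kill it. -/
theorem rootSubspace_eq_iInf_maxGenEigenspace [FiniteDimensional ℂ V] {A : Fin d → Module.End ℂ V}
    (hA : ∀ i j, Commute (A i) (A j)) (lam : EuclideanSpace ℂ (Fin d)) :
    rootSubspace A lam = ⨅ j, (A j).maxGenEigenspace (lam j) := by
  refine le_antisymm (le_iInf fun j => ?_) ?_
  · classical
    intro v hv
    have h := (Submodule.mem_iInf _).1 hv ⟨Pi.single j (finrank ℂ V), by simp⟩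
    rw [LinearMap.mem_ker] at h
    rw [Module.End.mem_maxGenEigenspace]
    refine ⟨finrank ℂ V, ?_⟩
    have e : (List.ofFn fun i => (A i - lam i • (1 : Module.End ℂ V)) ^
        ((Pi.single j (finrank ℂ V) : Fin d → ℕ) i)).prod
        = (A j - lam j • (1 : Module.End ℂ V)) ^ finrank ℂ V :=
      prod_ofFn_pow_single _ (commute_sub_smul hA lam) j _
    rw [← e]
    exact h
  · refine le_iInf fun α => ?_
    have hmaps : ∀ i, ∀ w ∈ ⨅ j, (A j).maxGenEigenspace (lam j),
        A i w ∈ ⨅ j, (A j).maxGenEigenspace (lam j) := by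
      intro i w hw
      rw [Submodule.mem_iInf] at hw ⊢
      exact fun j => Module.End.mapsTo_maxGenEigenspace_of_comm (hA j i) _ (hw j)
    refine le_ker_prod_of_nilpotent _ (commute_sub_smul hA lam) _ _ ?_ ?_
      (Submodule.finrank_le _) α.1 α.2
    · intro j w hw
      exact sub_mem (hmaps j w hw) (Submodule.smul_mem _ _ hw)
    · intro j w hw
      exact (Module.End.mem_maxGenEigenspace _ _ _).1 ((Submodule.mem_iInf _).1 hw j)

/-- A nonzero joint generalized eigenspace contains a joint eigenvector. -/
theorem exists_joint_eigenvector {A : Fin d → Module.End ℂ V} (hA : ∀ i j, Commute (A i) (A j))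
    (c : Fin d → ℂ) (h : (⨅ j, (A j).maxGenEigenspace (c j)) ≠ ⊥) :
    ∃ v : V, v ≠ 0 ∧ ∀ j, A j v = c j • v := by
  set N : Fin d → Module.End ℂ V := fun j => A j - c j • (1 : Module.End ℂ V) with hNdef
  have hN : ∀ i j, Commute (N i) (N j) := commute_sub_smul hA c
  obtain ⟨v, hv, hv0⟩ := Submodule.exists_mem_ne_zero_of_ne_bot h
  have hmem : ∀ i, ∀ w ∈ ⨅ j, (A j).maxGenEigenspace (c j), ∃ k, (N i ^ k) w = 0 := fun i w hw =>
    (Module.End.mem_maxGenEigenspace _ _ _).1 ((Submodule.mem_iInf _).1 hw i)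
  have key : ∀ s : Finset (Fin d), ∃ v : V, v ≠ 0 ∧ (∀ i, ∃ k, (N i ^ k) v = 0) ∧
      ∀ i ∈ s, N i v = 0 := by
    intro s
    induction s using Finset.induction_on with
    | empty => exact ⟨v, hv0, fun i => hmem i v hv, by simp⟩
    | insert a s _ ih =>
      obtain ⟨w, hw0, hw, hws⟩ := ih
      classical
      -- With `k` the least exponent such that `N a ^ k` kills `w`, the vector `N a ^ (k - 1)`
      -- applied to `w` is nonzero and killed by `N a`; by commutativity it stays in the kernels
      -- already reached.
      have hk := Nat.find_spec (hw a)
      have hmin := fun m => Nat.find_min (hw a) (m := m)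
      set k := Nat.find (hw a) with hkdef
      have hk0 : k ≠ 0 := by
        intro h0
        rw [h0] at hk
        exact hw0 (by simpa using hk)
      have hcomm : ∀ i (m : ℕ) (u : V), (N i ^ m) ((N a ^ (k - 1)) u)
          = (N a ^ (k - 1)) ((N i ^ m) u) := fun i m u =>
        congrArg (fun T => T u) ((hN i a).pow_pow m (k - 1)).eq
      refine ⟨(N a ^ (k - 1)) w, hmin _ (by omega), fun i => ?_, fun i hi => ?_⟩
      · obtain ⟨m, hm⟩ := hw i
        exact ⟨m, by rw [hcomm, hm, map_zero]⟩
      · rcases Finset.mem_insert.1 hi with rfl | hi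
        · have : (N i ^ (k - 1 + 1)) w = 0 := by
            rw [Nat.sub_add_cancel (by omega)]
            exact hk
          rw [pow_succ'] at this
          exact this
        · have := hcomm i 1 w
          rw [pow_one] at this
          rw [this, hws i hi, map_zero]
  obtain ⟨w, hw0, -, hw⟩ := key Finset.univ
  refine ⟨w, hw0, fun j => sub_eq_zero.1 ?_⟩
  have := hw j (Finset.mem_univ j)
  simpa [hNdef] using this

theorem iSup_iInf_maxGenEigenspace_eq_top [FiniteDimensional ℂ V] {A : Fin d → Module.End ℂ V}
    (hA : ∀ i j, Commute (A i) (A j)) :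
    ⨆ χ : Fin d → ℂ, ⨅ i, (A i).maxGenEigenspace (χ i) = ⊤ :=
  Module.End.iSup_iInf_maxGenEigenspace_eq_top_of_iSup_maxGenEigenspace_eq_top_of_commute A
    (fun i j _ => hA i j) fun i => Module.End.iSup_maxGenEigenspace_eq_top (A i)

/-- The joint eigenvalue of a joint eigenvector of the transposed tuple is a joint eigenvalue. -/
theorem exists_joint_eigenvector_of_functional [FiniteDimensional ℂ V] {A : Fin d → Module.End ℂ V}
    (hA : ∀ i j, Commute (A i) (A j)) (c : Fin d → ℂ) (f : V →ₗ[ℂ] ℂ) (hf : f ≠ 0)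
    (h : ∀ j v, f (A j v) = c j * f v) :
    ∃ v : V, v ≠ 0 ∧ ∀ j, A j v = c j • v := by
  refine exists_joint_eigenvector hA c fun hbot => hf ?_
  have hker : (⊤ : Submodule ℂ V) ≤ LinearMap.ker f := by
    rw [← iSup_iInf_maxGenEigenspace_eq_top hA]
    refine iSup_le fun χ => ?_
    by_cases hχ : χ = c
    · rw [hχ, hbot]
      exact bot_le
    obtain ⟨j, hj⟩ := Function.ne_iff.1 hχ
    intro v hv
    obtain ⟨k, hk⟩ := (Module.End.mem_maxGenEigenspace _ _ _).1 ((Submodule.mem_iInf _).1 hv j)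
    -- Transposed, `A j - χ j` acts on `f` as the nonzero scalar `c j - χ j`, so `f` vanishes on
    -- every generalized eigenspace other than that of `c`. If that one were trivial, `f` would be
    -- zero.
    have hp : ∀ (k : ℕ) (v : V), f (((A j - χ j • (1 : Module.End ℂ V)) ^ k) v)
        = (c j - χ j) ^ k * f v := by
      intro k
      induction k with
      | zero => simp
      | succ k ih =>
        intro v
        rw [pow_succ, Module.End.mul_apply, ih]
        simp [h]
        ring
    have h1 := hp k v
    rw [hk, map_zero] at h1
    exact (mul_eq_zero.1 h1.symm).resolve_left (pow_ne_zero _ (sub_ne_zero.2 hj.symm))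
  exact LinearMap.ext fun v => hker trivial

theorem mem_jointSpectrum_iff {A : Fin d → Module.End ℂ V} {lam : EuclideanSpace ℂ (Fin d)} :
    lam ∈ jointSpectrum A ↔ ∃ v : V, v ≠ 0 ∧ ∀ j, A j v = lam j • v := by
  rw [jointSpectrum, Set.mem_ofPred_eq, Submodule.ne_bot_iff]
  simp only [Submodule.mem_iInf, LinearMap.mem_ker, LinearMap.sub_apply, LinearMap.smul_apply,
    Module.End.one_apply, sub_eq_zero]
  exact ⟨fun ⟨v, h1, h2⟩ => ⟨v, h2, h1⟩, fun ⟨v, h1, h2⟩ => ⟨v, h2, h1⟩⟩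

theorem mem_jointSpectrum_iff_rootSubspace [FiniteDimensional ℂ V] {A : Fin d → Module.End ℂ V}
    (hA : ∀ i j, Commute (A i) (A j)) {lam : EuclideanSpace ℂ (Fin d)} :
    lam ∈ jointSpectrum A ↔ rootSubspace A lam ≠ ⊥ := by
  rw [rootSubspace_eq_iInf_maxGenEigenspace hA, mem_jointSpectrum_iff]
  constructor
  · rintro ⟨v, hv0, hv⟩
    refine (Submodule.ne_bot_iff _).2 ⟨v, (Submodule.mem_iInf _).2 fun j => ?_, hv0⟩
    exact (Module.End.mem_maxGenEigenspace _ _ _).2 ⟨1, by simp [hv j]⟩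
  · exact exists_joint_eigenvector hA fun j => lam j

/-- A commuting tuple with joint spectrum in the ball has a joint spectrum with multiplicities. -/
theorem exists_isJointSpectrumWithMult [FiniteDimensional ℂ V] {n : ℕ} {A : Fin d → Module.End ℂ V}
    (hA : ∀ i j, Commute (A i) (A j)) (hn : finrank ℂ V = n)
    (hσ : jointSpectrum A ⊆ Metric.ball 0 1) :
    ∃ X : SymPolyball d n, IsJointSpectrumWithMult A X := by
  classical
  set R : (Fin d → ℂ) → Submodule ℂ V := fun χ => ⨅ i, (A i).maxGenEigenspace (χ i) with hR
  have hind : iSupIndep R := Module.End.independent_iInf_maxGenEigenspace_of_forall_mapsTo A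
    fun i j φ => Module.End.mapsTo_maxGenEigenspace_of_comm (hA j i) φ
  have hInt : DirectSum.IsInternal R :=
    DirectSum.isInternal_submodule_of_iSupIndep_of_iSup_eq_top hind
      (iSup_iInf_maxGenEigenspace_eq_top hA)
  have hfin : {χ | R χ ≠ ⊥}.Finite := WellFoundedGT.finite_ne_bot_of_iSupIndep hind
  -- The trace of the identity over the decomposition counts dimensions.
  have hsum : n = ∑ χ ∈ hfin.toFinset, finrank ℂ (R χ) := by
    have h := LinearMap.trace_eq_sum_trace_restrict' hInt hfin
      (f := (LinearMap.id : V →ₗ[ℂ] V)) fun i v hv => hv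
    have h1 : ∀ χ, LinearMap.restrict (p := R χ) (q := R χ) (LinearMap.id : V →ₗ[ℂ] V)
        (fun v hv => hv) = LinearMap.id := fun χ => rfl
    simp only [h1, LinearMap.trace_id] at h
    rw [hn] at h
    exact_mod_cast h
  have hball : ∀ χ ∈ hfin.toFinset, WithLp.toLp 2 χ ∈
      Metric.ball (0 : EuclideanSpace ℂ (Fin d)) 1 := by
    intro χ hχ
    refine hσ ((mem_jointSpectrum_iff_rootSubspace hA).2 ?_)
    rw [rootSubspace_eq_iInf_maxGenEigenspace hA]
    exact (Set.Finite.mem_toFinset hfin).1 hχ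
  set S : Multiset (UnitBall d) := ∑ χ ∈ hfin.toFinset.attach,
    Multiset.replicate (finrank ℂ (R χ.1)) (⟨WithLp.toLp 2 χ.1, hball χ.1 χ.2⟩ : UnitBall d) with hS
  have hcard : Multiset.card S = n := by
    rw [hS, Multiset.card_sum]
    simp only [Multiset.card_replicate]
    rw [Finset.sum_attach hfin.toFinset fun χ => finrank ℂ (R χ), ← hsum]
  refine ⟨⟨S, hcard⟩, hσ, fun lam => ?_⟩
  have hcount : Multiset.count lam S = if R (lam : EuclideanSpace ℂ (Fin d)).ofLp ≠ ⊥ then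
      finrank ℂ (R (lam : EuclideanSpace ℂ (Fin d)).ofLp) else 0 := by
    rw [hS, Multiset.count_sum']
    simp only [Multiset.count_replicate]
    have e : ∀ χ : hfin.toFinset, ((⟨WithLp.toLp 2 χ.1, hball χ.1 χ.2⟩ : UnitBall d) = lam) ↔
        χ.1 = (lam : EuclideanSpace ℂ (Fin d)).ofLp := by
      intro χ
      constructor
      · rintro rfl; rfl
      · intro h
        exact Subtype.ext (by simp [h])
    simp only [e]
    rw [Finset.sum_attach hfin.toFinset fun χ =>
      if χ = (lam : EuclideanSpace ℂ (Fin d)).ofLp then finrank ℂ (R χ) else 0,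
      Finset.sum_ite_eq']
    simp
  change Multiset.count lam S = _
  have e : rootSubspace A lam = R (lam : EuclideanSpace ℂ (Fin d)).ofLp :=
    rootSubspace_eq_iInf_maxGenEigenspace hA _
  have e' : finrank ℂ (rootSubspace A lam) = finrank ℂ (R (lam : EuclideanSpace ℂ (Fin d)).ofLp) := by
    rw [e]
  simp only [hcount, mem_jointSpectrum_iff_rootSubspace hA, e', e]

end JointSpectrum

/-! ### Joint eigenvectors of the adjoint coordinate multiplications -/

/-- The square root of the multinomial coefficient. -/
def monomialWeight {d : ℕ} (α : Fin d → ℕ) : ℝ :=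
  Real.sqrt (((∑ j, α j).factorial : ℝ) / ∏ j, ((α j).factorial : ℝ))

theorem monomialWeight_pos {d : ℕ} (α : Fin d → ℕ) : 0 < monomialWeight α :=
  Real.sqrt_pos.2 (by positivity)

open Classical in
/-- The monomial `z^α` as an element of the Drury-Arveson space. -/
def monomialVec {d : ℕ} (α : Fin d → ℕ) : DruryArveson d :=
  (lp.single 2 α ((monomialWeight α : ℂ)⁻¹) : lp (fun _ : Fin d → ℕ => ℂ) 2)

theorem inner_monomialVec {d : ℕ} (α : Fin d → ℕ) (f : DruryArveson d) :
    ⟪monomialVec α, f⟫_ℂ = (monomialWeight α : ℂ)⁻¹ * coeff f α := by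
  classical
  have h := lp.inner_single_left (𝕜 := ℂ) (G := fun _ : Fin d → ℕ => ℂ) α
    ((monomialWeight α : ℂ)⁻¹) f
  refine Eq.trans ?_ (h.trans ?_)
  · simp only [monomialVec]
    congr!
  · simp [RCLike.inner_apply, coeff, mul_comm]

theorem monomialVec_apply {d : ℕ} (α : Fin d → ℕ) (z : UnitBall d) :
    monomialVec α z = ∏ j, (z : EuclideanSpace ℂ (Fin d)) j ^ α j := by
  have hw : (monomialWeight α : ℂ) ≠ 0 := by exact_mod_cast (monomialWeight_pos α).ne'
  have h : coeff (kernelVec z) α = (starRingEnd ℂ) (normMonomial α z) := rfl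
  rw [apply_eq_inner, ← inner_conj_symm, inner_monomialVec, h, map_mul, Complex.conj_conj,
    map_inv₀, Complex.conj_ofReal, normMonomial, ← monomialWeight, inv_mul_cancel_left₀ hw]

theorem coordShift_monomialVec {d : ℕ} (j : Fin d) (α : Fin d → ℕ) :
    coordShift j (monomialVec α) = monomialVec (α + Pi.single j 1) := by
  refine RKHS.ext (𝕜 := ℂ) (X := UnitBall d) (V := ℂ) fun z => ?_
  rw [coordShift_apply, monomialVec_apply, monomialVec_apply]
  simp only [Pi.add_apply, pow_add, Finset.prod_mul_distrib]
  rw [mul_comm]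
  congr 1
  rw [Finset.prod_eq_single j]
  · simp
  · intro i _ hi
    simp [hi]
  · simp

/-- Every monomial is obtained from `1` by coordinate multiplications, and each of these, moved to
the other side, contributes an eigenvalue. -/
theorem inner_monomialVec_of_eigenvector {d : ℕ} {v : DruryArveson d} {c : Fin d → ℂ}
    (h : ∀ j, ContinuousLinearMap.adjoint (coordShift j) v = c j • v) (α : Fin d → ℕ) :
    ⟪monomialVec α, v⟫_ℂ = (∏ j, c j ^ α j) * ⟪monomialVec 0, v⟫_ℂ := by
  generalize hm : ∑ j, α j = m
  induction m generalizing α with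
  | zero =>
    have : α = 0 := funext fun j => (Finset.sum_eq_zero_iff.1 hm) j (Finset.mem_univ j)
    simp [this]
  | succ m ih =>
    obtain ⟨i, hi⟩ : ∃ i, 0 < α i := by
      by_contra! h0
      rw [Finset.sum_eq_zero fun j _ => Nat.le_zero.1 (h0 j)] at hm
      omega
    set β := Function.update α i (α i - 1) with hβ
    have hα : α = β + Pi.single i 1 := by
      ext j
      by_cases hj : j = i
      · subst hj
        simp [hβ]
        omega
      · simp [hβ, hj]
    have hp : ∏ j, c j ^ α j = c i * ∏ j, c j ^ β j := by
      have := prod_ofFn_pow_eq_mul_of_comm c α i hi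
      rw [List.prod_ofFn, List.prod_ofFn] at this
      rw [this, mul_comm]
    rw [hp, mul_assoc, ← ih β (sum_update_pred α i hi m hm), hα, ← coordShift_monomialVec,
      ← ContinuousLinearMap.adjoint_inner_right, h, inner_smul_right]

/-- Joint eigenvectors of the adjoint coordinate multiplications are multiples of kernel
functions. -/
theorem eigenvector_eq_smul_kernelVec {d : ℕ} {v : DruryArveson d} (hv : v ≠ 0)
    {lam : EuclideanSpace ℂ (Fin d)}
    (h : ∀ j, ContinuousLinearMap.adjoint (coordShift j) v = (starRingEnd ℂ) (lam j) • v) :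
    ∃ hl : lam ∈ Metric.ball 0 1, ∃ c : ℂ, c ≠ 0 ∧ v = c • kernelVec ⟨lam, hl⟩ := by
  set g := ⟪monomialVec 0, v⟫_ℂ with hg
  have hcoeff : ∀ α, coeff v α = g * (starRingEnd ℂ) (normMonomial α lam) := by
    intro α
    have hw : (monomialWeight α : ℂ) ≠ 0 := by exact_mod_cast (monomialWeight_pos α).ne'
    have h1 := inner_monomialVec_of_eigenvector h α
    rw [inner_monomialVec, inv_mul_eq_iff_eq_mul₀ hw] at h1
    rw [h1, normMonomial, ← monomialWeight, map_mul, map_prod, Complex.conj_ofReal]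
    simp only [map_pow]
    ring
  have hg0 : g ≠ 0 := by
    intro h0
    refine hv (lp.ext (funext fun α => ?_))
    have := hcoeff α
    rw [h0, zero_mul] at this
    exact this
  have hs : Summable fun α : Fin d → ℕ => ‖coeff v α‖ ^ 2 := by
    have := (lp.memℓp (show lp (fun _ : Fin d → ℕ => ℂ) 2 from v)).summable (by norm_num)
    simpa [coeff] using this
  have hs' : Summable fun α : Fin d → ℕ => ‖normMonomial α lam‖ ^ 2 := by
    have h2 := hs.mul_left (‖g‖ ^ 2)⁻¹
    refine h2.congr fun α => ?_
    have : ‖g‖ ≠ 0 := norm_ne_zero_iff.2 hg0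
    rw [hcoeff, norm_mul, RCLike.norm_conj]
    field_simp
  -- Square summability of the coefficients, summed degree by degree, is convergence of the
  -- geometric series in `‖lam‖ ^ 2`; this is what forces `lam` into the ball.
  have hgeo : Summable fun m : ℕ => (‖lam‖ ^ 2) ^ m := by
    refine (hasSum_sum_piAntidiag hs'.hasSum).summable.congr fun m => ?_
    rw [EuclideanSpace.norm_sq_eq, Finset.sum_pow_eq_sum_piAntidiag]
    exact (Finset.sum_congr rfl fun α _ => norm_normMonomial_sq α lam)
  have hl : lam ∈ Metric.ball 0 1 := by
    rw [summable_geometric_iff_norm_lt_one, Real.norm_of_nonneg (by positivity)] at hgeo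
    rw [mem_ball_zero_iff]
    nlinarith [norm_nonneg lam]
  exact ⟨hl, g, hg0, lp.ext (funext hcoeff)⟩

/-! ### The joint spectrum of the compression -/

section Compression

variable {d n : ℕ}

theorem apply_of_mem_range (P : coinvariantProj d n) {v : DruryArveson d}
    (hv : v ∈ (P.1 : DruryArveson d →ₗ[ℂ] DruryArveson d).range) : P.1 v = v := by
  obtain ⟨u, rfl⟩ := hv
  exact congrArg (fun T => T u) P.2.1

theorem adjoint_mulOp_mem_range (P : coinvariantProj d n) {f : UnitBall d → ℂ}
    (hf : f ∈ multiplierAlgebra d) {v : DruryArveson d}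
    (hv : v ∈ (P.1 : DruryArveson d →ₗ[ℂ] DruryArveson d).range) :
    ContinuousLinearMap.adjoint (mulOp f) v
      ∈ (P.1 : DruryArveson d →ₗ[ℂ] DruryArveson d).range := by
  have h := congrArg (fun T => T v) (P.2.2.2.1 f hf)
  simp only [ContinuousLinearMap.comp_apply, apply_of_mem_range P hv] at h
  exact ⟨_, h⟩

theorem adjoint_coordShift_mem_range (P : coinvariantProj d n) (j : Fin d) {v : DruryArveson d}
    (hv : v ∈ (P.1 : DruryArveson d →ₗ[ℂ] DruryArveson d).range) :
    ContinuousLinearMap.adjoint (coordShift j) v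
      ∈ (P.1 : DruryArveson d →ₗ[ℂ] DruryArveson d).range :=
  adjoint_mulOp_mem_range P (coord_mem_multiplierAlgebra j) hv

theorem inner_apply_eq (P : coinvariantProj d n) {v : DruryArveson d}
    (hv : v ∈ (P.1 : DruryArveson d →ₗ[ℂ] DruryArveson d).range) (f : DruryArveson d) :
    ⟪v, P.1 f⟫_ℂ = ⟪v, f⟫_ℂ := by
  rw [← ContinuousLinearMap.adjoint_inner_left, P.2.2.1, apply_of_mem_range P hv]

/-- The compression is the adjoint of the restriction of `M_z^*` to the range of `P`, which that
operator preserves. -/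
theorem inner_compressedShift (P : coinvariantProj d n) (j : Fin d)
    (v w : (P.1 : DruryArveson d →ₗ[ℂ] DruryArveson d).range) :
    ⟪(v : DruryArveson d), compressedShift P.1 j w⟫_ℂ
      = ⟪ContinuousLinearMap.adjoint (coordShift j) (v : DruryArveson d), (w : DruryArveson d)⟫_ℂ := by
  rw [ContinuousLinearMap.adjoint_inner_left]
  exact inner_apply_eq P v.2 _

theorem coordShift_comm (i j : Fin d) (f : DruryArveson d) :
    coordShift i (coordShift j f) = coordShift j (coordShift i f) := by
  refine RKHS.ext (𝕜 := ℂ) (X := UnitBall d) (V := ℂ) fun z => ?_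
  simp only [coordShift_apply]
  ring

theorem adjoint_coordShift_comm (i j : Fin d) (f : DruryArveson d) :
    ContinuousLinearMap.adjoint (coordShift i) (ContinuousLinearMap.adjoint (coordShift j) f)
      = ContinuousLinearMap.adjoint (coordShift j)
        (ContinuousLinearMap.adjoint (coordShift i) f) := by
  refine ext_inner_right ℂ fun g => ?_
  simp only [ContinuousLinearMap.adjoint_inner_left, coordShift_comm i j]

/-- The restriction of the adjoint coordinate multiplication to the range of `P`. -/
def adjointShift (P : coinvariantProj d n) (j : Fin d) :
    Module.End ℂ (P.1 : DruryArveson d →ₗ[ℂ] DruryArveson d).range :=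
  (ContinuousLinearMap.adjoint (coordShift j) : DruryArveson d →ₗ[ℂ] DruryArveson d).restrict
    fun _ hv => adjoint_coordShift_mem_range P j hv

theorem commute_adjointShift (P : coinvariantProj d n) (i j : Fin d) :
    Commute (adjointShift P i) (adjointShift P j) :=
  LinearMap.ext fun v => Subtype.ext (adjoint_coordShift_comm i j v)

theorem commute_compressedShift (P : coinvariantProj d n) (i j : Fin d) :
    Commute (compressedShift P.1 i) (compressedShift P.1 j) := by
  refine LinearMap.ext fun w => ?_
  refine ext_inner_left ℂ fun v => ?_
  have key : ∀ i j, ⟪(v : DruryArveson d), compressedShift P.1 i (compressedShift P.1 j w)⟫_ℂ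
      = ⟪ContinuousLinearMap.adjoint (coordShift j)
        (ContinuousLinearMap.adjoint (coordShift i) (v : DruryArveson d)), (w : DruryArveson d)⟫_ℂ := by
    intro i j
    rw [inner_compressedShift]
    exact inner_compressedShift P j ⟨_, adjoint_coordShift_mem_range P i v.2⟩ w
  change ⟪(v : DruryArveson d), compressedShift P.1 i (compressedShift P.1 j w)⟫_ℂ
    = ⟪(v : DruryArveson d), compressedShift P.1 j (compressedShift P.1 i w)⟫_ℂ
  rw [key, key, adjoint_coordShift_comm]

/-- Pairing with an eigenvector of the compression is an eigenfunctional of the restricted adjoints.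
In finite dimension this yields an eigenvector of the adjoints with the conjugate eigenvalue, hence
a kernel function in the range. -/
theorem exists_kernelVec_mem_of_mem_jointSpectrum (P : coinvariantProj d n)
    {lam : EuclideanSpace ℂ (Fin d)} (h : lam ∈ jointSpectrum (compressedShift P.1)) :
    ∃ hl : lam ∈ Metric.ball 0 1,
      kernelVec ⟨lam, hl⟩ ∈ (P.1 : DruryArveson d →ₗ[ℂ] DruryArveson d).range := by
  have := P.2.2.2.2.1
  obtain ⟨v, hv0, hv⟩ := mem_jointSpectrum_iff.1 h
  let f : (P.1 : DruryArveson d →ₗ[ℂ] DruryArveson d).range →ₗ[ℂ] ℂ := innerₛₗ ℂ v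
  have hf : ∀ w, f w = ⟪(v : DruryArveson d), (w : DruryArveson d)⟫_ℂ := fun w => rfl
  have hf0 : f ≠ 0 := by
    intro h0
    have := congrArg (fun T => T v) h0
    simp only [hf, LinearMap.zero_apply, inner_self_eq_zero] at this
    exact hv0 (Subtype.ext this)
  have hfA : ∀ j w, f (adjointShift P j w) = (starRingEnd ℂ) (lam j) * f w := by
    intro j w
    have h1 := inner_compressedShift P j w v
    rw [hv j] at h1
    have h2 := congrArg (starRingEnd ℂ) h1
    rw [inner_conj_symm, inner_conj_symm] at h2
    rw [hf, hf]
    change ⟪(v : DruryArveson d),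
      ContinuousLinearMap.adjoint (coordShift j) (w : DruryArveson d)⟫_ℂ = _
    rw [← h2, Submodule.coe_smul, inner_smul_left]
  obtain ⟨w, hw0, hw⟩ := exists_joint_eigenvector_of_functional (commute_adjointShift P)
    (fun j => (starRingEnd ℂ) (lam j)) f hf0 hfA
  have hw' : ∀ j, ContinuousLinearMap.adjoint (coordShift j) (w : DruryArveson d)
      = (starRingEnd ℂ) (lam j) • (w : DruryArveson d) := fun j => congrArg Subtype.val (hw j)
  obtain ⟨hl, c, hc, hwc⟩ := eigenvector_eq_smul_kernelVec (by simpa using hw0) hw'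
  refine ⟨hl, ?_⟩
  have := Submodule.smul_mem _ c⁻¹ w.2
  rwa [hwc, smul_smul, inv_mul_cancel₀ hc, one_smul] at this

theorem jointSpectrum_subset_ball (P : coinvariantProj d n) :
    jointSpectrum (compressedShift P.1) ⊆ Metric.ball 0 1 := fun _ h =>
  (exists_kernelVec_mem_of_mem_jointSpectrum P h).1

/-- For the converse, pairing with `k_lam` is an eigenfunctional of the compressed tuple, to which
the same duality applies. -/
theorem mem_jointSpectrum_compressedShift_iff (P : coinvariantProj d n) (lam : UnitBall d) :
    (lam : EuclideanSpace ℂ (Fin d)) ∈ jointSpectrum (compressedShift P.1) ↔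
      kernelVec lam ∈ (P.1 : DruryArveson d →ₗ[ℂ] DruryArveson d).range := by
  refine ⟨fun h => (exists_kernelVec_mem_of_mem_jointSpectrum P h).2, fun h => ?_⟩
  have := P.2.2.2.2.1
  set v : (P.1 : DruryArveson d →ₗ[ℂ] DruryArveson d).range := ⟨kernelVec lam, h⟩ with hv
  let f : (P.1 : DruryArveson d →ₗ[ℂ] DruryArveson d).range →ₗ[ℂ] ℂ := innerₛₗ ℂ v
  have hf : ∀ w, f w = ⟪(v : DruryArveson d), (w : DruryArveson d)⟫_ℂ := fun w => rfl
  refine mem_jointSpectrum_iff.2 (exists_joint_eigenvector_of_functional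
    (commute_compressedShift P) (fun j => (lam : EuclideanSpace ℂ (Fin d)) j) f ?_ ?_)
  · intro h0
    have := congrArg (fun T => T v) h0
    simp only [hf, LinearMap.zero_apply, inner_self_eq_zero] at this
    exact kernelVec_ne_zero lam this
  · intro j w
    rw [hf, hf, inner_compressedShift]
    rw [show ContinuousLinearMap.adjoint (coordShift j) (v : DruryArveson d) = _ from
      (isMultiplicationOp_mulOp (coord_mem_multiplierAlgebra j)).adjoint_kernelVec lam,
      inner_smul_left, Complex.conj_conj]

theorem isJointSpectrumWithMult_Psi (P : coinvariantProj d n) :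
    IsJointSpectrumWithMult (compressedShift P.1) (Psi d n P) := by
  have := P.2.2.2.2.1
  have h : ∃ X : SymPolyball d n, IsJointSpectrumWithMult (compressedShift P.1) X :=
    exists_isJointSpectrumWithMult (commute_compressedShift P) P.2.2.2.2.2
      (jointSpectrum_subset_ball P)
  rw [Psi, dif_pos h]
  exact h.choose_spec

theorem mem_Psi_iff (P : coinvariantProj d n) (lam : UnitBall d) :
    lam ∈ (Psi d n P).1 ↔
      kernelVec lam ∈ (P.1 : DruryArveson d →ₗ[ℂ] DruryArveson d).range := by
  classical
  have := P.2.2.2.2.1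
  rw [← mem_jointSpectrum_compressedShift_iff, ← Multiset.count_pos]
  have h := (isJointSpectrumWithMult_Psi P).2 lam
  constructor
  · intro hpos
    by_contra hσ
    rw [if_neg hσ] at h
    have : Multiset.count lam (Psi d n P).1 = 0 := by convert h
    omega
  · intro hσ
    rw [if_pos hσ] at h
    have h1 : Multiset.count lam (Psi d n P).1
        = Module.finrank ℂ (rootSubspace (compressedShift P.1) lam) := by convert h
    rw [h1]
    exact Nat.pos_of_ne_zero fun h0 =>
      (mem_jointSpectrum_iff_rootSubspace (commute_compressedShift P)).1 hσ
        (Submodule.finrank_eq_zero.1 h0)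

/-! ### Projections onto spans of kernel functions -/

theorem kernelProj_mem_coinvariantProj {s : Multiset (UnitBall d)} (hs : s.Nodup)
    (hn : Multiset.card s = n) : kernelProj s ∈ coinvariantProj d n := by
  refine ⟨kernelProj_comp_self s, adjoint_kernelProj s, fun f hf => ?_, ?_, ?_⟩
  · ext1 g
    simp only [ContinuousLinearMap.comp_apply]
    refine Submodule.starProjection_eq_self_iff.2 ?_
    have hinv : ∀ v ∈ kernelSpan s,
        ContinuousLinearMap.adjoint (mulOp f) v ∈ kernelSpan s := by
      intro v hv
      refine Submodule.span_induction
        (p := fun v _ => ContinuousLinearMap.adjoint (mulOp f) v ∈ kernelSpan s) ?_ ?_ ?_ ?_ hv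
      · rintro _ ⟨x, hx, rfl⟩
        rw [(isMultiplicationOp_mulOp hf).adjoint_kernelVec]
        exact Submodule.smul_mem _ _ (kernelVec_mem_kernelSpan hx)
      · rw [map_zero]; exact zero_mem _
      · intro a b _ _ ha hb
        rw [map_add]; exact add_mem ha hb
      · intro c a _ ha
        rw [map_smul]; exact Submodule.smul_mem _ _ ha
    exact hinv _ (Submodule.starProjection_apply_mem _ _)
  · rw [range_kernelProj]; infer_instance
  · rw [range_kernelProj, finrank_kernelSpan hs, hn]

/-- Every point of `s` occurs in Ψ, and both multisets have `n` elements, so there is room for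
nothing else. -/
theorem Psi_kernelProj {s : Multiset (UnitBall d)} (hs : s.Nodup) (hn : Multiset.card s = n) :
    (Psi d n ⟨kernelProj s, kernelProj_mem_coinvariantProj hs hn⟩).1 = s := by
  symm
  refine Multiset.eq_of_le_of_card_le ((Multiset.le_iff_subset hs).2 fun x hx => ?_) ?_
  · rw [mem_Psi_iff, range_kernelProj]
    exact kernelVec_mem_kernelSpan hx
  · rw [hn]
    exact (Psi d n _).2.le

/-- The kernel functions at the `n` distinct points of Ψ(P) lie in the range of `P` and are
independent, so they span this `n`-dimensional space. -/
theorem eq_kernelProj_Psi (P : coinvariantProj d n) (hP : (Psi d n P).1.Nodup) :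
    P.1 = kernelProj (Psi d n P).1 := by
  have := P.2.2.2.2.1
  have hle : kernelSpan (Psi d n P).1 ≤ (P.1 : DruryArveson d →ₗ[ℂ] DruryArveson d).range := by
    refine Submodule.span_le.2 ?_
    rintro _ ⟨x, hx, rfl⟩
    exact (mem_Psi_iff P x).1 hx
  have heq := Submodule.eq_of_le_of_finrank_eq hle (by
    rw [finrank_kernelSpan hP, P.2.2.2.2.2]
    exact (Psi d n P).2)
  ext1 f
  symm
  refine Submodule.eq_starProjection_of_mem_orthogonal (K := kernelSpan (Psi d n P).1) ?_ ?_
  · rw [heq]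
    exact ⟨f, rfl⟩
  · rw [heq]
    intro v hv
    rw [inner_sub_right, inner_apply_eq P hv, sub_self]

end Compression

open Filter Topology

/-! ### The pseudohyperbolic distance -/

section Distance

variable {d : ℕ}

theorem continuous_pseudohyperbolicDist (x : UnitBall d) :
    Continuous (pseudohyperbolicDist x) := by
  have h1 : Continuous fun z : UnitBall d =>
      lineProj (x : EuclideanSpace ℂ (Fin d)) (z : EuclideanSpace ℂ (Fin d)) := by
    simp only [lineProj]
    fun_prop
  have h2 : Continuous fun z : UnitBall d =>
      (1 - ⟪(x : EuclideanSpace ℂ (Fin d)), z⟫_ℂ)⁻¹ :=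
    Continuous.inv₀ (by fun_prop) fun z => one_sub_inner_ne_zero x z
  have h3 : Continuous fun z : UnitBall d =>
      ((x : EuclideanSpace ℂ (Fin d)) - lineProj (x : EuclideanSpace ℂ (Fin d)) z -
        (Real.sqrt (1 - ‖(x : EuclideanSpace ℂ (Fin d))‖ ^ 2) : ℂ) •
          ((z : EuclideanSpace ℂ (Fin d)) - lineProj (x : EuclideanSpace ℂ (Fin d)) z)) := by
    fun_prop
  exact (h2.smul h3).norm

theorem pseudohyperbolicDist_sq_mul (x z : UnitBall d) :
    (1 - pseudohyperbolicDist x z ^ 2) *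
        Complex.normSq (1 - ⟪(x : EuclideanSpace ℂ (Fin d)), z⟫_ℂ)
      = (1 - ‖(x : EuclideanSpace ℂ (Fin d))‖ ^ 2) *
        (1 - ‖(z : EuclideanSpace ℂ (Fin d))‖ ^ 2) := by
  have h := one_sub_inner_ballInvolution x z z
  have n1 := one_sub_inner_ne_zero x z
  have n2 := one_sub_inner_ne_zero z x
  rw [eq_div_iff (mul_ne_zero n1 n2), inner_self_eq_norm_sq_to_K, inner_self_eq_norm_sq_to_K,
    inner_self_eq_norm_sq_to_K] at h
  have hc : (1 - ⟪(x : EuclideanSpace ℂ (Fin d)), z⟫_ℂ) *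
      (1 - ⟪(z : EuclideanSpace ℂ (Fin d)), x⟫_ℂ)
      = (Complex.normSq (1 - ⟪(x : EuclideanSpace ℂ (Fin d)), z⟫_ℂ) : ℂ) := by
    rw [← Complex.mul_conj, map_sub, map_one, inner_conj_symm]
  rw [hc] at h
  unfold pseudohyperbolicDist
  refine Complex.ofReal_injective ?_
  push_cast
  exact h

theorem pseudohyperbolicDist_self (x : UnitBall d) : pseudohyperbolicDist x x = 0 := by
  have h := pseudohyperbolicDist_sq_mul x x
  have e : Complex.normSq (1 - ⟪(x : EuclideanSpace ℂ (Fin d)), x⟫_ℂ)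
      = (1 - ‖(x : EuclideanSpace ℂ (Fin d))‖ ^ 2) ^ 2 := by
    rw [inner_self_eq_norm_sq_to_K]
    have : (1 - ((‖(x : EuclideanSpace ℂ (Fin d))‖ : ℝ) : ℂ) ^ 2)
        = ((1 - ‖(x : EuclideanSpace ℂ (Fin d))‖ ^ 2 : ℝ) : ℂ) := by push_cast; rfl
    exact (congrArg Complex.normSq this).trans (by rw [Complex.normSq_ofReal, ← sq])
  have hx := norm_coe_lt_one x
  have hpos : 0 < 1 - ‖(x : EuclideanSpace ℂ (Fin d))‖ ^ 2 := by
    nlinarith [norm_nonneg (x : EuclideanSpace ℂ (Fin d))]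
  rw [e] at h
  have h2 : pseudohyperbolicDist x x ^ 2 * (1 - ‖(x : EuclideanSpace ℂ (Fin d))‖ ^ 2) ^ 2 = 0 := by
    linear_combination -h
  simpa [hpos.ne'] using h2

/-- Multiplied by `|1 - ⟨z, x⟩| ^ 2`, which is at most `4`, the squared pseudohyperbolic distance
exceeds the left side by exactly `(Re⟨z, x⟩ - ‖x‖ ^ 2) ^ 2 + (Im⟨z, x⟩) ^ 2`. -/
theorem norm_sub_sq_le_pseudohyperbolicDist (x z : UnitBall d) :
    (1 - ‖(x : EuclideanSpace ℂ (Fin d))‖ ^ 2) * ‖(x - z : EuclideanSpace ℂ (Fin d))‖ ^ 2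
      ≤ 4 * pseudohyperbolicDist x z ^ 2 := by
  have h := pseudohyperbolicDist_sq_mul x z
  have hn : ‖(x - z : EuclideanSpace ℂ (Fin d))‖ ^ 2 = ‖(x : EuclideanSpace ℂ (Fin d))‖ ^ 2
      - 2 * (⟪(x : EuclideanSpace ℂ (Fin d)), z⟫_ℂ).re + ‖(z : EuclideanSpace ℂ (Fin d))‖ ^ 2 :=
    @norm_sub_sq ℂ _ _ _ _ _ _
  have hN : Complex.normSq (1 - ⟪(x : EuclideanSpace ℂ (Fin d)), z⟫_ℂ) ≤ 4 := by
    rw [Complex.normSq_eq_norm_sq]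
    have h1 := norm_sub_le (1 : ℂ) ⟪(x : EuclideanSpace ℂ (Fin d)), z⟫_ℂ
    have h2 := norm_inner_lt_one x z
    rw [norm_one] at h1
    nlinarith [norm_nonneg (1 - ⟪(x : EuclideanSpace ℂ (Fin d)), z⟫_ℂ)]
  have hN' : Complex.normSq (1 - ⟪(x : EuclideanSpace ℂ (Fin d)), z⟫_ℂ)
      = (1 - (⟪(x : EuclideanSpace ℂ (Fin d)), z⟫_ℂ).re) ^ 2
        + (⟪(x : EuclideanSpace ℂ (Fin d)), z⟫_ℂ).im ^ 2 := by
    rw [Complex.normSq_apply]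
    simp
    ring
  have hp : pseudohyperbolicDist x z ^ 2 *
      Complex.normSq (1 - ⟪(x : EuclideanSpace ℂ (Fin d)), z⟫_ℂ)
      ≤ 4 * pseudohyperbolicDist x z ^ 2 := by
    nlinarith [sq_nonneg (pseudohyperbolicDist x z)]
  refine le_trans ?_ hp
  rw [sub_mul, one_mul] at h
  have hq : pseudohyperbolicDist x z ^ 2 *
      Complex.normSq (1 - ⟪(x : EuclideanSpace ℂ (Fin d)), z⟫_ℂ)
      = Complex.normSq (1 - ⟪(x : EuclideanSpace ℂ (Fin d)), z⟫_ℂ) -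
        (1 - ‖(x : EuclideanSpace ℂ (Fin d))‖ ^ 2) *
        (1 - ‖(z : EuclideanSpace ℂ (Fin d))‖ ^ 2) := by linarith
  rw [hq, hN', hn]
  nlinarith [sq_nonneg ((⟪(x : EuclideanSpace ℂ (Fin d)), z⟫_ℂ).re
    - ‖(x : EuclideanSpace ℂ (Fin d))‖ ^ 2), sq_nonneg (⟪(x : EuclideanSpace ℂ (Fin d)), z⟫_ℂ).im]

theorem exists_dist_lt_of_pseudohyperbolicDist_lt (x : UnitBall d) {ε : ℝ} (hε : 0 < ε) :
    ∃ δ > 0, ∀ z, pseudohyperbolicDist x z < δ → dist z x < ε := by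
  have hx := norm_coe_lt_one x
  have hpos : 0 < 1 - ‖(x : EuclideanSpace ℂ (Fin d))‖ ^ 2 := by
    nlinarith [norm_nonneg (x : EuclideanSpace ℂ (Fin d))]
  set c := 1 - ‖(x : EuclideanSpace ℂ (Fin d))‖ ^ 2 with hc
  refine ⟨Real.sqrt c * ε / 2, by positivity, fun z hz => ?_⟩
  have h := norm_sub_sq_le_pseudohyperbolicDist x z
  have h0 : 0 ≤ pseudohyperbolicDist x z := norm_nonneg _
  have h1 : pseudohyperbolicDist x z ^ 2 < (Real.sqrt c * ε / 2) ^ 2 :=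
    pow_lt_pow_left₀ hz h0 two_ne_zero
  rw [div_pow, mul_pow, Real.sq_sqrt hpos.le] at h1
  have h2 : c * ‖(x - z : EuclideanSpace ℂ (Fin d))‖ ^ 2 < c * ε ^ 2 := by linarith
  have h3 := lt_of_mul_lt_mul_left h2 hpos.le
  have h4 := lt_of_pow_lt_pow_left₀ 2 hε.le h3
  rwa [dist_comm, Subtype.dist_eq, dist_eq_norm]

end Distance

/-! ### The topology of the symmetrized polyball -/

section Topology

variable {d n : ℕ}

theorem coe_symmetrize (x : Fin n → UnitBall d) :
    (symmetrize x).1 = ((List.ofFn x : List (UnitBall d)) : Multiset (UnitBall d)) :=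
  Fin.univ_val_map x

theorem symmetrize_comp_perm (x : Fin n → UnitBall d) (σ : Equiv.Perm (Fin n)) :
    symmetrize (x ∘ σ) = symmetrize x := by
  refine Subtype.ext ?_
  rw [coe_symmetrize, coe_symmetrize]
  exact Multiset.coe_eq_coe.2 (Equiv.Perm.ofFn_comp_perm σ x)

/-- The fibres of the two tuples over each point have equal size, and matching them gives the
permutation. -/
theorem exists_perm_of_symmetrize_eq {x y : Fin n → UnitBall d}
    (h : symmetrize x = symmetrize y) : ∃ σ : Equiv.Perm (Fin n), x ∘ σ = y := by
  classical
  have h1 : Finset.univ.val.map x = Finset.univ.val.map y := congrArg Subtype.val h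
  have hcard : ∀ c, Fintype.card {i // y i = c} = Fintype.card {i // x i = c} := by
    intro c
    have h2 := congrArg (Multiset.count c) h1
    rw [Multiset.count_map, Multiset.count_map] at h2
    rw [Fintype.card_subtype, Fintype.card_subtype, Finset.card_def, Finset.card_def,
      Finset.filter_val, Finset.filter_val]
    simp only [eq_comm (b := c)]
    exact h2.symm
  refine ⟨Equiv.ofFiberEquiv fun c => Fintype.equivOfCardEq (hcard c), ?_⟩
  funext i
  exact Equiv.ofFiberEquiv_map _ i

theorem symmetrize_surjective : Function.Surjective (symmetrize (d := d) (n := n)) := by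
  rintro ⟨s, hs⟩
  obtain ⟨l, rfl⟩ := Quot.exists_rep s
  have hl : l.length = n := hs
  subst hl
  refine ⟨l.get, Subtype.ext ?_⟩
  rw [coe_symmetrize, List.ofFn_get]
  rfl

theorem mem_configSpace_iff {X : SymPolyball d n} : X ∈ configSpace d n ↔ X.1.Nodup := by
  constructor
  · rintro ⟨x, hx, rfl⟩
    rw [coe_symmetrize]
    exact Multiset.coe_nodup.2 (List.nodup_ofFn.2 hx)
  · intro h
    obtain ⟨x, rfl⟩ := symmetrize_surjective X
    rw [coe_symmetrize] at h
    exact ⟨x, List.nodup_ofFn.1 (Multiset.coe_nodup.1 h), rfl⟩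

theorem symDist_symmetrize_le (x y : Fin n → UnitBall d) :
    symDist (symmetrize x) (symmetrize y) ≤ ⨆ j, pseudohyperbolicDist (x j) (y j) := by
  refine csInf_le ⟨0, ?_⟩ ⟨x, y, rfl, rfl, rfl⟩
  rintro _ ⟨x, y, -, -, rfl⟩
  exact Real.iSup_nonneg fun j => norm_nonneg _

/-- A near-optimal pair of orderings can be permuted simultaneously, so the ordering of the first
tuple may be fixed in advance. -/
theorem exists_of_symDist_lt {x : Fin n → UnitBall d} {Y : SymPolyball d n} {ε : ℝ}
    (h : symDist (symmetrize x) Y < ε) :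
    ∃ y, symmetrize y = Y ∧ ∀ j, pseudohyperbolicDist (x j) (y j) < ε := by
  obtain ⟨y₀, hy₀⟩ := symmetrize_surjective Y
  obtain ⟨r, ⟨x', y', hx', hy', rfl⟩, hr⟩ := exists_lt_of_csInf_lt
    (by exact ⟨_, x, y₀, rfl, hy₀, rfl⟩) h
  obtain ⟨σ, hσ⟩ := exists_perm_of_symmetrize_eq hx'
  refine ⟨y' ∘ σ, by rw [symmetrize_comp_perm, hy'], fun j => ?_⟩
  rw [← hσ]
  exact (le_ciSup (f := fun j => pseudohyperbolicDist (x' j) (y' j))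
    (Set.finite_range _).bddAbove (σ j)).trans_lt hr

/-- The topology of the symmetric distance is the quotient topology. -/
theorem isOpen_symPolyball_iff {U : Set (SymPolyball d n)} :
    IsOpen U ↔ IsOpen (symmetrize ⁻¹' U) := by
  constructor
  · intro hU
    rw [isOpen_iff_mem_nhds]
    intro x hx
    obtain ⟨ε, hε, h⟩ := hU _ hx
    have hnear : ∀ᶠ y in 𝓝 x, ∀ j, pseudohyperbolicDist (x j) (y j) < ε / 2 := by
      rw [eventually_all]
      intro j
      have hc : Continuous fun y : Fin n → UnitBall d => pseudohyperbolicDist (x j) (y j) :=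
        (continuous_pseudohyperbolicDist (x j)).comp (by fun_prop)
      refine (hc.tendsto x).eventually_lt_const ?_
      rw [pseudohyperbolicDist_self]
      linarith
    filter_upwards [hnear] with y hy
    refine h _ ((symDist_symmetrize_le x y).trans_lt ?_)
    have : ⨆ j, pseudohyperbolicDist (x j) (y j) ≤ ε / 2 :=
      Real.iSup_le (fun j => (hy j).le) (by linarith)
    linarith
  · intro hU X hX
    obtain ⟨x, rfl⟩ := symmetrize_surjective X
    obtain ⟨ε, hε, hball⟩ := Metric.isOpen_iff.1 hU x hX
    choose δ hδ hδε using fun j => exists_dist_lt_of_pseudohyperbolicDist_lt (x j) hε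
    obtain ⟨δ₀, hδ₀, hle⟩ : ∃ δ₀ > 0, ∀ j, δ₀ ≤ δ j := by
      have : ∀ s : Finset (Fin n), ∃ δ₀ > 0, ∀ j ∈ s, δ₀ ≤ δ j := by
        intro s
        induction s using Finset.induction_on with
        | empty => exact ⟨1, one_pos, by simp⟩
        | insert a s _ ih =>
          obtain ⟨δ₀, h0, h1⟩ := ih
          refine ⟨min δ₀ (δ a), lt_min h0 (hδ a), fun j hj => ?_⟩
          rcases Finset.mem_insert.1 hj with rfl | hj
          · exact min_le_right _ _
          · exact (min_le_left _ _).trans (h1 j hj)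
      obtain ⟨δ₀, h0, h1⟩ := this Finset.univ
      exact ⟨δ₀, h0, fun j => h1 j (Finset.mem_univ j)⟩
    refine ⟨δ₀, hδ₀, fun Y hY => ?_⟩
    obtain ⟨y, rfl, hy⟩ := exists_of_symDist_lt hY
    refine hball ?_
    rw [Metric.mem_ball, dist_pi_lt_iff hε]
    exact fun j => hδε j _ ((hy j).trans_le (hle j))

/-- The symmetrization is continuous and open: the saturation of an open set is the union of its
images under permutations. Limits can thus be computed on ordered tuples. -/
theorem nhds_symmetrize (x : Fin n → UnitBall d) :
    𝓝 (symmetrize x) = Filter.map symmetrize (𝓝 x) := by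
  refine le_antisymm ?_ ?_
  · refine IsOpenMap.nhds_le (fun O hO => ?_) x
    rw [isOpen_symPolyball_iff]
    have : symmetrize ⁻¹' (symmetrize '' O)
        = ⋃ σ : Equiv.Perm (Fin n), (fun y : Fin n → UnitBall d => y ∘ σ) ⁻¹' O := by
      ext y
      simp only [Set.mem_preimage, Set.mem_image, Set.mem_iUnion]
      constructor
      · rintro ⟨z, hz, hzy⟩
        obtain ⟨σ, rfl⟩ := exists_perm_of_symmetrize_eq hzy.symm
        exact ⟨σ, hz⟩
      · rintro ⟨σ, hσ⟩
        exact ⟨_, hσ, symmetrize_comp_perm y σ⟩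
    rw [this]
    have hσ : ∀ σ : Equiv.Perm (Fin n), Continuous fun y : Fin n → UnitBall d => y ∘ σ :=
      fun σ => continuous_pi fun j => continuous_apply (σ j)
    exact isOpen_iUnion fun σ => hO.preimage (hσ σ)
  · have hc : Continuous (symmetrize (d := d) (n := n)) :=
      ⟨fun U hU => isOpen_symPolyball_iff.1 hU⟩
    exact hc.tendsto x

theorem setOf_injective_mem_nhds {x : Fin n → UnitBall d} (hx : Function.Injective x) :
    {y : Fin n → UnitBall d | Function.Injective y} ∈ 𝓝 x := by
  have h : ∀ᶠ y in 𝓝 x, ∀ i j, i ≠ j → y i ≠ y j := by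
    rw [eventually_all]
    intro i
    rw [eventually_all]
    intro j
    by_cases hij : i = j
    · exact Eventually.of_forall fun y h => absurd hij h
    · have ho : IsOpen {y : Fin n → UnitBall d | y i ≠ y j} :=
        isOpen_ne_fun (continuous_apply i) (continuous_apply j)
      filter_upwards [ho.mem_nhds fun h => hij (hx h)] with y hy _ using hy
  filter_upwards [h] with y hy i j hij
  by_contra hne
  exact hy i j hne hij

end Topology

/-! ### The homeomorphism -/

section Homeomorphism

variable {d n : ℕ}

theorem nodup_of_mem_config (X : configSpace d n) : X.1.1.Nodup :=
  mem_configSpace_iff.1 X.2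

/-- The map sending `n` distinct points to the projection onto the span of their kernel
functions. -/
def Phi (d n : ℕ) (X : configSpace d n) : coinvariantProjDistinct d n :=
  ⟨⟨kernelProj X.1.1, kernelProj_mem_coinvariantProj (nodup_of_mem_config X) X.1.2⟩, by
    change Psi d n _ ∈ configSpace d n
    rw [mem_configSpace_iff, Psi_kernelProj (nodup_of_mem_config X) X.1.2]
    exact nodup_of_mem_config X⟩

theorem Psi_Phi (X : configSpace d n) : Psi d n (Phi d n X).1 = X.1 :=
  Subtype.ext (Psi_kernelProj (nodup_of_mem_config X) X.1.2)

theorem Phi_Psi (P : coinvariantProjDistinct d n) : Phi d n ⟨Psi d n P.1, P.2⟩ = P :=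
  Subtype.ext (Subtype.ext (eq_kernelProj_Psi P.1 (mem_configSpace_iff.1 P.2)).symm)

theorem continuous_Phi : Continuous (Phi d n) := by
  refine Continuous.subtype_mk (Continuous.subtype_mk ?_ _) _
  refine continuous_iff_continuousAt.2 fun X => ?_
  obtain ⟨x, hx, hxX⟩ := X.2
  have h : ContinuousAt (fun Y : SymPolyball d n => kernelProj Y.1) X.1 := by
    rw [ContinuousAt, ← hxX, nhds_symmetrize, tendsto_map'_iff]
    have h1 := (continuousAt_kernelProj_ofFn x hx).tendsto
    have e : ((fun Y : SymPolyball d n => kernelProj Y.1) ∘ symmetrize)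
        = fun y : Fin n → UnitBall d =>
          kernelProj ((List.ofFn y : List (UnitBall d)) : Multiset (UnitBall d)) := by
      funext y
      rw [Function.comp_apply, coe_symmetrize]
    rw [e, coe_symmetrize]
    exact h1
  exact h.comp continuous_subtype_val.continuousAt

/-- Near each point of the spectrum of `P` there is a point of the spectrum of any projection `Q`
close to `P`. -/
theorem exists_mem_Psi_near {C : ℝ} (hC : ∀ (x : UnitBall d) (s : Multiset (UnitBall d)),
      Multiset.card s = n → ∃ f : DruryArveson d, ‖f‖ ≤ C ∧ (∀ y ∈ s, f y = 0) ∧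
      f x = (((s.map fun y : UnitBall d =>
        ‖(x - y : EuclideanSpace ℂ (Fin d))‖ ^ 2).prod : ℝ) : ℂ))
    (P Q : coinvariantProj d n) (hQ : (Psi d n Q).1.Nodup) {x : UnitBall d}
    (hx : x ∈ (Psi d n P).1) {δ : ℝ} (hδ : 0 < δ)
    (h : ‖P.1 - Q.1‖ * ‖kernelVec x‖ * C < (δ ^ 2) ^ n) :
    ∃ y ∈ (Psi d n Q).1, dist y x < δ := by
  by_contra! hfar
  obtain ⟨f, hfC, hf0, hfx⟩ := hC x (Psi d n Q).1 (Psi d n Q).2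
  have hprod : (δ ^ 2) ^ n ≤ ((Psi d n Q).1.map fun y : UnitBall d =>
      ‖(x - y : EuclideanSpace ℂ (Fin d))‖ ^ 2).prod := by
    have h1 := Multiset.prod_map_le_prod_map₀ (s := (Psi d n Q).1) (fun _ => δ ^ 2)
      (fun y : UnitBall d => ‖(x - y : EuclideanSpace ℂ (Fin d))‖ ^ 2)
      (fun y _ => by positivity) fun y hy => by
        have := hfar y hy
        rw [dist_comm, Subtype.dist_eq, dist_eq_norm] at this
        gcongr
    rwa [Multiset.map_const', Multiset.prod_replicate,
      show Multiset.card (Psi d n Q).1 = n from (Psi d n Q).2] at h1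
  have hPx : P.1 (kernelVec x) = kernelVec x :=
    apply_of_mem_range P ((mem_Psi_iff P x).1 hx)
  have hQf : Q.1 f = 0 := by
    rw [eq_kernelProj_Psi Q hQ]
    refine (Submodule.starProjection_apply_eq_zero_iff _).2 fun v hv => ?_
    refine Submodule.span_induction (p := fun v _ => ⟪v, f⟫_ℂ = 0) ?_ (by simp) ?_ ?_ hv
    · rintro _ ⟨y, hy, rfl⟩
      exact hf0 y hy
    · intro a b _ _ ha hb
      rw [inner_add_left, ha, hb, add_zero]
    · intro c a _ ha
      rw [inner_smul_left, ha, mul_zero]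
  -- As `P` fixes `k_x` and `Q f = 0`, the value `f x` sees only `P - Q`. It is therefore small,
  -- whereas points at distance at least `δ` make it at least `δ ^ (2 n)`.
  have hval : f x = ⟪(P.1 - Q.1) (kernelVec x), f⟫_ℂ := by
    have hQ0 : ⟪Q.1 (kernelVec x), f⟫_ℂ = 0 := by
      rw [← ContinuousLinearMap.adjoint_inner_right, Q.2.2.1, hQf, inner_zero_right]
    rw [sub_apply, hPx, inner_sub_left, hQ0, sub_zero, apply_eq_inner]
  have hle : ‖f x‖ ≤ ‖P.1 - Q.1‖ * ‖kernelVec x‖ * C := by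
    rw [hval]
    refine (norm_inner_le_norm _ _).trans ?_
    gcongr
    exact ContinuousLinearMap.le_opNorm _ _
  rw [hfx, Complex.norm_real, Real.norm_eq_abs] at hle
  have := le_abs_self ((Psi d n Q).1.map fun y : UnitBall d =>
      ‖(x - y : EuclideanSpace ℂ (Fin d))‖ ^ 2).prod
  linarith

theorem continuous_Psi_distinct :
    Continuous fun P : coinvariantProjDistinct d n => Psi d n P.1 := by
  refine continuous_iff_continuousAt.2 fun P => ?_
  obtain ⟨x, hx, hxP⟩ := P.2
  obtain ⟨C, -, hC⟩ := exists_interpolant d n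
  intro U hU
  change U ∈ 𝓝 (Psi d n P.1) at hU
  rw [← hxP, nhds_symmetrize, mem_map] at hU
  -- Within `δ` of `x` tuples are still injective, so nearby points of Ψ(Q) chosen one for each `x
  -- i` cannot coincide.
  obtain ⟨δ, hδ, hball⟩ := Metric.mem_nhds_iff.1 (inter_mem hU (setOf_injective_mem_nhds hx))
  have hmem : ∀ i, x i ∈ (Psi d n P.1).1 := by
    intro i
    rw [← hxP, coe_symmetrize]
    exact (List.mem_ofFn' x (x i)).2 ⟨i, rfl⟩
  have hev : ∀ᶠ Q : coinvariantProjDistinct d n in 𝓝 P, ∀ i,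
      ‖P.1.1 - Q.1.1‖ * ‖kernelVec (x i)‖ * C < (δ ^ 2) ^ n := by
    rw [eventually_all]
    intro i
    have hc : Continuous fun Q : coinvariantProjDistinct d n =>
        ‖P.1.1 - Q.1.1‖ * ‖kernelVec (x i)‖ * C := by fun_prop
    refine (hc.tendsto P).eventually_lt_const ?_
    rw [sub_self, norm_zero, zero_mul, zero_mul]
    positivity
  rw [mem_map]
  filter_upwards [hev] with Q hQ
  choose y hy hyx using fun i => exists_mem_Psi_near hC P.1 Q.1 (mem_configSpace_iff.1 Q.2)
    (hmem i) hδ (hQ i)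
  have hyb : y ∈ Metric.ball x δ := by
    rw [Metric.mem_ball, dist_pi_lt_iff hδ]
    exact hyx
  obtain ⟨hyU, hyinj⟩ := hball hyb
  -- The `y i` are `n` distinct elements of a multiset of size `n`, hence all of it.
  have hQy : symmetrize y = Psi d n Q.1 := by
    refine Subtype.ext (Multiset.eq_of_le_of_card_le ((Multiset.le_iff_subset ?_).2 ?_) ?_)
    · exact mem_configSpace_iff.1 ⟨y, hyinj, rfl⟩
    · intro z hz
      rw [coe_symmetrize] at hz
      obtain ⟨i, rfl⟩ := (List.mem_ofFn' y z).1 hz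
      exact hy i
    · exact ((Psi d n Q.1).2.trans (symmetrize y).2.symm).le
  change Psi d n Q.1 ∈ U
  rw [← hQy]
  exact hyU

/-- The restriction of `Ψ` to the preimage of the configuration space. -/
def psiHomeomorph (d n : ℕ) : coinvariantProjDistinct d n ≃ₜ configSpace d n where
  toFun P := ⟨Psi d n P.1, P.2⟩
  invFun := Phi d n
  left_inv := Phi_Psi
  right_inv X := Subtype.ext (Psi_Phi X)
  continuous_toFun := continuous_Psi_distinct.subtype_mk _
  continuous_invFun := continuous_Phi

/-! ### Ranges of the row multiplication operators -/

theorem span_range_kerFun (x : Fin n → UnitBall d) :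
    Submodule.span ℂ (Set.range fun i => RKHS.kerFun (DruryArveson d) (x i) 1)
      = kernelSpan ((List.ofFn x : List (UnitBall d)) : Multiset (UnitBall d)) := by
  rw [kernelSpan]
  congr 1
  ext v
  simp only [kerFun_one, Set.mem_range, Set.mem_image]
  constructor
  · rintro ⟨i, rfl⟩
    exact ⟨x i, (List.mem_ofFn' x (x i)).2 ⟨i, rfl⟩, rfl⟩
  · rintro ⟨y, hy, rfl⟩
    obtain ⟨i, rfl⟩ := (List.mem_ofFn' x y).1 hy
    exact ⟨i, rfl⟩

/-- Since `M = M M^* M`, the range of `M` is that of the projection `M M^* = I - kernelProj s`. -/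
theorem range_eq_orthogonal_of_comp_adjoint {E : Type*} [NormedAddCommGroup E]
    [InnerProductSpace ℂ E] [CompleteSpace E] (M : E →L[ℂ] DruryArveson d)
    (s : Multiset (UnitBall d))
    (hM : M ∘L ContinuousLinearMap.adjoint M
      = ContinuousLinearMap.id ℂ (DruryArveson d) - kernelProj s)
    (hM' : M ∘L ContinuousLinearMap.adjoint M ∘L M = M) :
    (M : E →ₗ[ℂ] DruryArveson d).range = (kernelSpan s)ᗮ := by
  refine le_antisymm ?_ ?_
  · rintro _ ⟨g, rfl⟩
    have h1 : M (ContinuousLinearMap.adjoint M (M g)) = M g := congrArg (fun T => T g) hM'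
    have h2 : M (ContinuousLinearMap.adjoint M (M g)) = M g - kernelProj s (M g) :=
      congrArg (fun T => T (M g)) hM
    change M g ∈ (kernelSpan s)ᗮ
    rw [← h1, h2]
    exact Submodule.sub_starProjection_mem_orthogonal _
  · intro v hv
    have h2 : M (ContinuousLinearMap.adjoint M v) = v - kernelProj s v :=
      congrArg (fun T => T v) hM
    have h3 : kernelProj s v = 0 := (Submodule.starProjection_apply_eq_zero_iff _).2 hv
    rw [h3, sub_zero] at h2
    exact ⟨_, h2⟩

end Homeomorphism

end

theorem theorem4p3 (d n : ℕ) (hd : 0 < d) (hn : 0 < n) :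
    -- `Ψ` is well defined on all of `ℙ_{d,n}`
    (∀ P : coinvariantProj d n, IsJointSpectrumWithMult (compressedShift P.1) (Psi d n P)) ∧
    ∃ Φ : configSpace d n → coinvariantProjDistinct d n,
      -- `Φ[X] = I - M_{b_X} M_{b_X}^*` for every ordering `x` of `X` and every choice of `b_X`
      (∀ (X : configSpace d n) (x : Fin n → UnitBall d), symmetrize x = X.1 →
        (∃ b : UnitBall d → EuclideanSpace ℂ (Fin ((n - 1) * (d - 1) + d)),
          IsBlaschkeRow (List.ofFn x) ((n - 1) * (d - 1) + d) b) ∧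
        ∀ (N : ℕ) (b : UnitBall d → EuclideanSpace ℂ (Fin N)), IsBlaschkeRow (List.ofFn x) N b →
          ∃ M : PiLp 2 (fun _ : Fin N => DruryArveson d) →L[ℂ] DruryArveson d,
            IsRowMultiplicationOp b M ∧
            M ∘L ContinuousLinearMap.adjoint M ∘L M = M ∧
            (M : PiLp 2 (fun _ : Fin N => DruryArveson d) →ₗ[ℂ] DruryArveson d).range =
              (Submodule.span ℂ (Set.range fun i => RKHS.kerFun (DruryArveson d) (x i) 1))ᗮ ∧
            ((Φ X).1.1 : DruryArveson d →L[ℂ] DruryArveson d) =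
              ContinuousLinearMap.id ℂ (DruryArveson d) - M ∘L ContinuousLinearMap.adjoint M) ∧
      Continuous Φ ∧
      (∀ X : configSpace d n, Psi d n (Φ X).1 = X.1) ∧
      (∀ P : coinvariantProjDistinct d n, Φ ⟨Psi d n P.1, P.2⟩ = P) ∧
      ∃ e : coinvariantProjDistinct d n ≃ₜ configSpace d n,
        (∀ P, (e P).1 = Psi d n P.1) ∧ ∀ X, e.symm X = Φ X := by
  refine ⟨isJointSpectrumWithMult_Psi, Phi d n, fun X x hxX => ⟨?_, fun N b hb => ?_⟩,
    continuous_Phi, Psi_Phi, Phi_Psi, psiHomeomorph d n, fun _ => rfl, fun _ => rfl⟩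
  · have hnd : (List.ofFn x).Nodup := by
      have := nodup_of_mem_config X
      rwa [← hxX, coe_symmetrize, Multiset.coe_nodup] at this
    have h := exists_isBlaschkeRow hd (List.ofFn x) hnd
      (List.ne_nil_of_length_pos (by rwa [List.length_ofFn]))
    rwa [List.length_ofFn] at h
  · obtain ⟨M, hM, hMM⟩ := hb.exists_mulOp
    have hX : kernelProj ((List.ofFn x : List (UnitBall d)) : Multiset (UnitBall d))
        = (Phi d n X).1.1 := by
      rw [← coe_symmetrize, hxX]
      rfl
    have hpi : M ∘L ContinuousLinearMap.adjoint M ∘L M = M := by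
      refine comp_adjoint_comp_self_of_idempotent M ?_
      rw [hMM]
      ext1 f
      have := congrArg (fun T => T f) (kernelProj_comp_self
        ((List.ofFn x : List (UnitBall d)) : Multiset (UnitBall d)))
      simp only [ContinuousLinearMap.comp_apply] at this
      simp [this]
    refine ⟨M, hM, hpi, ?_, ?_⟩
    · rw [span_range_kerFun]
      exact range_eq_orthogonal_of_comp_adjoint M _ hMM hpi
    · rw [hMM, ← hX, sub_sub_cancel]
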